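/- Let $p$ be a prime, let $R$ be an $F$-finite ring of characteristic $p$ (noetherian with finite Frobenius $F$), let $f\colon \operatorname{Spec} S\to\operatorname{Spec} R$ be a smooth morphism with $S$ of characteristic $p$, let $\mathfrak a\subseteq R$ be an ideal and $t\in\mathbb Q$. Let $M$ be an $R$-module with an $R$-linear map $\kappa\colon F_*M\to M$. *Notation.* $\kappa^{\mathfrak a^t}$ denotes the graded algebra of additive endomorphisms of $M$ whose degree $0$ part consists of the multiplications by elements of $R$ and whose degree $e\ge 1$ part $\mathcal C_e$ consists of the maps $m\mapsto\kappa^e(xm)$ with $x\in\mathfrak a^{\lceil tp^e\rceil}$ (with $\mathfrak a^n=R$ for $n\le 0$). For a graded algebra $\mathcal C$ of this kind, $M$ is *$F$-regular* if it is finitely generated, $\mathcal C_+M=M$, and every $\mathcal C$-stable submodule $N\subseteq M$ with $N_\eta=M_\eta$ for all generic points $\eta$ of $\operatorname{Supp}M$ equals $M$. Let $\omega_f$ be the invertible $S$-module of relative differential forms of top degree, so that $\omega_f=\bigwedge^n\Omega^1_{S/R}$ where $f$ has relative dimension $n$, and let $f^!M=\omega_f\otimes_S f^*M=\omega_f\otimes_R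 M$. There is a unique relative Cartier operator $\kappa_{rel}\colon\omega_f\to\omega_f\otimes_R F_*R$, i.e. a unique additive map with $\kappa_{rel}(s^p r\,\omega)=(s\otimes r)\,\kappa_{rel}(\omega)$ for $s\in S$, $r\in R$ which, on the part of $\operatorname{Spec}S$ of relative dimension $n$, kills all $ds_1\wedge\dots\wedge ds_n$ (if $n\ge 1$) and sends $s_1^{p-1}ds_1\wedge\dots\wedge s_n^{p-1}ds_n$ to $(ds_1\wedge\dots\wedge ds_n)\otimes 1$. The induced Cartier structure $\kappa_{f^!M}\colon F_*f^!M\to f^!M$ sends $\omega\otimes m$ to $\sum_i\omega_i\otimes\kappa(r_im)$ if $\kappa_{rel}(\omega)=\sum_i\omega_i\otimes r_i$. **Theorem.** If $M$ is $F$-regular with respect to $\kappa^{\mathfrak a^t}$, then $f^!M$ is $F$-regular with respect to $(\kappa_{f^!M})^{(\mathfrak aS)^t}$. -/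

import Mathlib

open scoped TensorProduct

noncomputable section

/-- The Frobenius pushforward `F_* M` of a module `M` over a ring `R` of characteristic `p`:
the same abelian group, on which `r : R` acts as `r ^ p`. -/
def FrobeniusPushforward (_p : ℕ) (_R M : Type*) : Type _ := M

namespace FrobeniusPushforward

instance (p : ℕ) (R M : Type*) [AddCommGroup M] : AddCommGroup (FrobeniusPushforward p R M) :=
  inferInstanceAs (AddCommGroup M)

/-- The identity, as an additive map `M → F_* M`. -/
def of (p : ℕ) (R : Type*) {M : Type*} [AddCommGroup M] : M ≃+ FrobeniusPushforward p R M :=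
  AddEquiv.refl M

instance (p : ℕ) (R M : Type*) [CommRing R] [Fact p.Prime] [CharP R p] [AddCommGroup M]
    [Module R M] : Module R (FrobeniusPushforward p R M) :=
  Module.compHom M (frobenius R p)

theorem smul_of (p : ℕ) {R M : Type*} [CommRing R] [Fact p.Prime] [CharP R p] [AddCommGroup M]
    [Module R M] (r : R) (m : M) : r • of p R m = of p R (r ^ p • m) := rfl

/-- For `m : M`, the `R`-linear map `F_* R → F_* M`, `x ↦ x m`. For `M = R` this is the
multiplication by an element of the ring `F_* R`. -/
def orbitMap (p : ℕ) {R M : Type*} [CommRing R] [Fact p.Prime] [CharP R p] [AddCommGroup M]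
    [Module R M] (m : M) : FrobeniusPushforward p R R →ₗ[R] FrobeniusPushforward p R M where
  toFun x := of p R ((of p R).symm x • m)
  map_add' x y := by simp [add_smul]
  map_smul' r x := by
    obtain ⟨x, rfl⟩ := (of p R).surjective x
    simp [smul_of, mul_smul]

end FrobeniusPushforward

/-- A Cartier structure `κ : F_* M → M`, viewed as an additive endomorphism of `M`. -/
def cartierEnd {p : ℕ} {R M : Type*} [CommRing R] [Fact p.Prime] [CharP R p] [AddCommGroup M]
    [Module R M] (κ : FrobeniusPushforward p R M →ₗ[R] M) : AddMonoid.End M :=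
  κ.toAddMonoidHom.comp (FrobeniusPushforward.of p R).toAddMonoidHom

theorem cartierEnd_apply {p : ℕ} {R M : Type*} [CommRing R] [Fact p.Prime] [CharP R p]
    [AddCommGroup M] [Module R M] (κ : FrobeniusPushforward p R M →ₗ[R] M) (m : M) :
    cartierEnd κ m = κ (FrobeniusPushforward.of p R m) := rfl

theorem cartierEnd_pow_smul {p : ℕ} {R M : Type*} [CommRing R] [Fact p.Prime] [CharP R p]
    [AddCommGroup M] [Module R M] (κ : FrobeniusPushforward p R M →ₗ[R] M) (e : ℕ) (r : R)
    (m : M) : (cartierEnd κ ^ e) (r ^ p ^ e • m) = r • (cartierEnd κ ^ e) m := by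
  induction e generalizing m with
  | zero => simp
  | succ e ih =>
    have h : ∀ x : M, (cartierEnd κ ^ (e + 1)) x =
        (cartierEnd κ ^ e) (κ (FrobeniusPushforward.of p R x)) := fun x => by
      rw [pow_succ]; rfl
    rw [h, h, pow_succ, pow_mul, ← FrobeniusPushforward.smul_of, map_smul, ih]

/-- A Cartier algebra acting on `M`: an `ℕ`-graded family of additive endomorphisms of `M`,
closed under composition, whose degree zero part consists of the multiplications by elements of
`R`, and whose elements `φ` of degree `e` satisfy `r φ = φ r ^ (p ^ e)`. -/
structure CartierAlgebra (p : ℕ) (R M : Type*) [CommRing R] [AddCommGroup M] [Module R M] where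
  /-- The homogeneous elements of degree `e`. -/
  deg : ℕ → AddSubgroup (AddMonoid.End M)
  mem_deg_zero : ∀ φ : AddMonoid.End M, φ ∈ deg 0 ↔ ∃ r : R, ∀ m, φ m = r • m
  mul_mem : ∀ (d e : ℕ) (φ ψ : AddMonoid.End M), φ ∈ deg d → ψ ∈ deg e → φ * ψ ∈ deg (d + e)
  map_pow_smul : ∀ (e : ℕ) (φ : AddMonoid.End M), φ ∈ deg e →
    ∀ (r : R) (m : M), φ (r ^ p ^ e • m) = r • φ m

namespace CartierAlgebra

/-- The Cartier submodules of `M`. -/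
def IsCartierSubmodule {p : ℕ} {R M : Type*} [CommRing R] [AddCommGroup M] [Module R M]
    (C : CartierAlgebra p R M) (N : Submodule R M) : Prop :=
  ∀ (e : ℕ), ∀ φ ∈ C.deg e, ∀ m ∈ N, φ m ∈ N

/-- The submodule `C₊ N` spanned by the `φ n` with `n ∈ N` and `φ` homogeneous of positive
degree. -/
def plus {p : ℕ} {R M : Type*} [CommRing R] [AddCommGroup M] [Module R M]
    (C : CartierAlgebra p R M) (N : Submodule R M) : Submodule R M :=
  Submodule.span R {x | ∃ e : ℕ, 0 < e ∧ ∃ φ ∈ C.deg e, ∃ n ∈ N, φ n = x}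

/-- `M` is `F`-pure if `C₊ M = M`. -/
def IsFPure {p : ℕ} {R M : Type*} [CommRing R] [AddCommGroup M] [Module R M]
    (C : CartierAlgebra p R M) : Prop :=
  C.plus ⊤ = ⊤

end CartierAlgebra

/-- The submodule `N` of `M` agrees with `M` at every generic point of the support of `M`. -/
def AgreesGenerically {R M : Type*} [CommRing R] [AddCommGroup M] [Module R M]
    (N : Submodule R M) : Prop :=
  ∀ η : PrimeSpectrum R, Minimal (· ∈ Module.support R M) η →
    N.localized η.asIdeal.primeCompl = ⊤

/-- `F`-regularity: `M` is coherent and `F`-pure, and no proper Cartier submodule of `M` agrees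
with `M` at all generic points of its support. -/
structure CartierAlgebra.IsFRegular {p : ℕ} {R M : Type*} [CommRing R] [AddCommGroup M]
    [Module R M] (C : CartierAlgebra p R M) : Prop where
  finite : Module.Finite R M
  isFPure : C.IsFPure
  eq_top : ∀ N : Submodule R M, C.IsCartierSubmodule N → AgreesGenerically N → N = ⊤

/-- The coefficient ideals of `κ ^ (𝔞 ^ t)`: the unit ideal in degree zero and `𝔞 ^ ⌈t p ^ e⌉` in
degree `e > 0`. The rounding up takes values in `ℕ`, so that negative exponents give the unit
ideal. -/
def testIdealPow (p : ℕ) {R : Type*} [CommRing R] (a : Ideal R) (t : ℚ) (e : ℕ) : Ideal R :=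
  if e = 0 then ⊤ else a ^ ⌈t * (p : ℚ) ^ e⌉₊

theorem testIdealPow_mul (p : ℕ) {R : Type*} [CommRing R] (a : Ideal R) (t : ℚ) (d e : ℕ)
    {x y : R} (hx : x ∈ testIdealPow p a t d) (hy : y ∈ testIdealPow p a t e) :
    x ^ p ^ e * y ∈ testIdealPow p a t (d + e) := by
  unfold testIdealPow at *
  rcases Nat.eq_zero_or_pos d with rfl | hd
  · rw [zero_add]
    exact Ideal.mul_mem_left _ _ hy
  · rw [if_neg hd.ne'] at hx
    rw [if_neg (by omega)]
    refine Ideal.mul_mem_right _ _ ?_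
    have h1 : x ^ p ^ e ∈ a ^ (⌈t * (p : ℚ) ^ d⌉₊ * p ^ e) := by
      rw [pow_mul]
      exact Ideal.pow_mem_pow hx _
    refine Ideal.pow_le_pow_right ?_ h1
    rw [Nat.ceil_le]
    push_cast
    rw [pow_add, ← mul_assoc]
    exact mul_le_mul_of_nonneg_right (Nat.le_ceil _) (by positivity)

/-- The Cartier algebra `κ ^ (𝔞 ^ t)` generated over `R` by the maps `m ↦ κ ^ e (x m)`, where
`e > 0` and `x ∈ 𝔞 ^ ⌈t p ^ e⌉`; these maps are already all its elements of degree `e`. -/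
def idealPowCartierAlgebra {p : ℕ} {R M : Type*} [CommRing R] [Fact p.Prime] [CharP R p]
    [AddCommGroup M] [Module R M] (κ : FrobeniusPushforward p R M →ₗ[R] M) (a : Ideal R)
    (t : ℚ) : CartierAlgebra p R M where
  deg e :=
    { carrier := {φ | ∃ x ∈ testIdealPow p a t e, ∀ m, φ m = (cartierEnd κ ^ e) (x • m)}
      zero_mem' := ⟨0, zero_mem _, fun m => by simp⟩
      add_mem' := by
        rintro φ ψ ⟨x, hx, hφ⟩ ⟨y, hy, hψ⟩
        exact ⟨x + y, add_mem hx hy, fun m => by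
          rw [add_smul, map_add, ← hφ, ← hψ]; rfl⟩
      neg_mem' := by
        rintro φ ⟨x, hx, hφ⟩
        exact ⟨-x, neg_mem hx, fun m => by
          rw [neg_smul, map_neg, ← hφ]; rfl⟩ }
  mem_deg_zero φ := by
    constructor
    · rintro ⟨x, -, hφ⟩
      exact ⟨x, fun m => by simpa using hφ m⟩
    · rintro ⟨x, hφ⟩
      exact ⟨x, by simp [testIdealPow], fun m => by simpa using hφ m⟩
  mul_mem := by
    rintro d e φ ψ ⟨x, hx, hφ⟩ ⟨y, hy, hψ⟩
    refine ⟨x ^ p ^ e * y, testIdealPow_mul p a t d e hx hy, fun m => ?_⟩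
    have h : (φ * ψ) m = φ (ψ m) := rfl
    have h' : ∀ x : M, (cartierEnd κ ^ (d + e)) x = (cartierEnd κ ^ d) ((cartierEnd κ ^ e) x) :=
      fun x => by rw [pow_add]; rfl
    rw [h, h', hφ, hψ, mul_smul, cartierEnd_pow_smul]
  map_pow_smul := by
    rintro e φ ⟨x, -, hφ⟩ r m
    rw [hφ, hφ, smul_comm, cartierEnd_pow_smul]

/-- The relative dualizing module `ω_f` of a smooth `R`-algebra `S`: the module of top degree
relative differential forms. Since the relative dimension is only locally constant on `Spec S`,
the degree is prescribed locally: a form is in `ω_f` if around every prime `P` it is homogeneous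
of degree the rank of `Ω[S⁄R]` at `P`. -/
def relTopForms (R S : Type*) [CommRing R] [CommRing S] [Algebra R S] :
    Submodule S (ExteriorAlgebra S (Ω[S⁄R])) where
  carrier := {z | ∀ P : PrimeSpectrum S, ∃ s : S, s ∉ P.asIdeal ∧
    s • z ∈ ⋀[S]^(Module.rankAtStalk (Ω[S⁄R]) P) (Ω[S⁄R])}
  zero_mem' P := ⟨1, P.asIdeal.one_notMem, by simp⟩
  add_mem' := by
    intro y z hy hz P
    obtain ⟨s, hs, hsy⟩ := hy P
    obtain ⟨u, hu, huz⟩ := hz P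
    refine ⟨s * u, fun h => (P.isPrime.mem_or_mem h).elim hs hu, ?_⟩
    rw [smul_add, mul_comm s u, mul_smul, mul_comm u s, mul_smul]
    exact add_mem (Submodule.smul_mem _ _ hsy) (Submodule.smul_mem _ _ huz)
  smul_mem' := by
    intro c z hz P
    obtain ⟨s, hs, hsz⟩ := hz P
    refine ⟨s, hs, ?_⟩
    rw [smul_comm]
    exact Submodule.smul_mem _ _ hsz

/-- In constant relative dimension `n`, `ω_f` is the `n`-th exterior power of `Ω[S⁄R]`. -/
theorem relTopForms_eq_exteriorPower (R S : Type*) [CommRing R] [CommRing S] [Algebra R S]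
    (n : ℕ) (hn : ∀ P : PrimeSpectrum S, Module.rankAtStalk (Ω[S⁄R]) P = n) :
    relTopForms R S = ⋀[S]^n (Ω[S⁄R]) := by
  ext z
  constructor
  · intro hz
    let I : Ideal S := Submodule.comap (LinearMap.toSpanSingleton S _ z)
      (⋀[S]^n (Ω[S⁄R]))
    by_cases hI : I = ⊤
    · have h1 : (1 : S) ∈ I := hI ▸ Submodule.mem_top
      simpa [I] using h1
    · obtain ⟨m, hm, hIm⟩ := Ideal.exists_le_maximal I hI
      obtain ⟨s, hs, hsz⟩ := hz ⟨m, hm.isPrime⟩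
      rw [hn] at hsz
      exact absurd (hIm (by simpa [I] using hsz)) hs
  · intro hz P
    exact ⟨1, P.asIdeal.one_notMem, by rw [hn, one_smul]; exact hz⟩

/-- The form `h ds₁ ∧ ⋯ ∧ dsₙ`. -/
def wedgeForm (R : Type*) {S : Type*} [CommRing R] [CommRing S] [Algebra R S] (h : S) {n : ℕ}
    (s : Fin n → S) : ExteriorAlgebra S (Ω[S⁄R]) :=
  h • ExteriorAlgebra.ιMulti S n (fun i => KaehlerDifferential.D R S (s i))

/-- A relative Cartier operator in top degree of the smooth `R`-algebra `S`. It is a map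
`ω_f → F'^* ω_f`, where `F'` is the base change of the Frobenius of `R` along `f`, so that
`F'^* ω_f = ω_f ⊗[S] (S ⊗[R] F_* R) = ω_f ⊗[R] F_* R`. It is linear over `S ⊗[R] F_* R`, where
`s ⊗ r` acts on `ω_f` as `s ^ p r` (relative Frobenius), it kills the exact forms
`d s₁ ∧ ⋯ ∧ d sₙ`, `n > 0`, and it sends `s₁ ^ (p - 1) ds₁ ∧ ⋯ ∧ sₙ ^ (p - 1) dsₙ` to
`(ds₁ ∧ ⋯ ∧ dsₙ) ⊗ 1`. The factor `h` in the last two conditions is present since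
`ds₁ ∧ ⋯ ∧ dsₙ` has top degree only on the part of `Spec S` of relative dimension `n`. -/
@[ext]
structure RelCartierOperator (p : ℕ) (R S : Type*) [CommRing R] [CommRing S] [Algebra R S]
    [Fact p.Prime] [CharP R p] where
  /-- The underlying additive map. -/
  toFun : relTopForms R S →+ relTopForms R S ⊗[R] FrobeniusPushforward p R R
  map_smul_base : ∀ (r : R) (z : relTopForms R S),
    toFun (r • z) = (FrobeniusPushforward.orbitMap p r).lTensor (relTopForms R S) (toFun z)
  map_pow_smul : ∀ (s : S) (z : relTopForms R S), toFun (s ^ p • z) = s • toFun z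
  map_exact : ∀ (n : ℕ) (s : Fin n → S) (h : S) (hz : wedgeForm R h s ∈ relTopForms R S),
    0 < n → toFun (h ^ (p - 1) • ⟨wedgeForm R h s, hz⟩) = 0
  map_log : ∀ (n : ℕ) (s : Fin n → S) (h : S) (hz : wedgeForm R h s ∈ relTopForms R S),
    toFun ((h ^ (p - 1) * ∏ i, s i ^ (p - 1)) • ⟨wedgeForm R h s, hz⟩) =
      (⟨wedgeForm R h s, hz⟩ : relTopForms R S) ⊗ₜ[R] FrobeniusPushforward.of p R (1 : R)

/-- The module `f^! M = ω_f ⊗[S] f^* M`, where `ω_f ⊗[S] (S ⊗[R] M)` is written as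
`ω_f ⊗[R] M`. -/
abbrev ShriekModule (R S M : Type*) [CommRing R] [CommRing S] [Algebra R S] [AddCommGroup M]
    [Module R M] : Type _ :=
  relTopForms R S ⊗[R] M

/-- For `(M, κ)` a Cartier module and `m : M`, the map `ω_f ⊗ F_* R → ω_f ⊗ M` with
`z ⊗ x ↦ z ⊗ κ (x m)`. It is obtained from the adjoint `m ↦ (x ↦ κ (x m))`, `M → F^! M`, of
`κ`. -/
def shriekAux {p : ℕ} {R : Type*} (S : Type*) {M : Type*} [CommRing R] [CommRing S] [Algebra R S]
    [Fact p.Prime] [CharP R p] [AddCommGroup M] [Module R M]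
    (κ : FrobeniusPushforward p R M →ₗ[R] M) (m : M) :
    relTopForms R S ⊗[R] FrobeniusPushforward p R R →ₗ[S] ShriekModule R S M :=
  TensorProduct.AlgebraTensorModule.lTensor S (relTopForms R S)
    (κ ∘ₗ FrobeniusPushforward.orbitMap p m)

theorem shriekAux_tmul {p : ℕ} {R S M : Type*} [CommRing R] [CommRing S] [Algebra R S]
    [Fact p.Prime] [CharP R p] [AddCommGroup M] [Module R M]
    (κ : FrobeniusPushforward p R M →ₗ[R] M) (m : M) (z : relTopForms R S) (x : R) :
    shriekAux S κ m (z ⊗ₜ[R] FrobeniusPushforward.of p R x) =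
      z ⊗ₜ[R] κ (FrobeniusPushforward.of p R (x • m)) := rfl

/-- The additive map underlying the Cartier structure of `f^! M`: if the relative Cartier operator
sends `z` to `∑ zᵢ ⊗ xᵢ`, then `z ⊗ m` is sent to `∑ zᵢ ⊗ κ (xᵢ m)`. -/
def shriekAddHom {p : ℕ} {R S M : Type*} [CommRing R] [CommRing S] [Algebra R S]
    [Fact p.Prime] [CharP R p] [AddCommGroup M] [Module R M] (K : RelCartierOperator p R S)
    (κ : FrobeniusPushforward p R M →ₗ[R] M) : ShriekModule R S M →+ ShriekModule R S M :=
  TensorProduct.liftAddHom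
    (AddMonoidHom.mk' (fun z => AddMonoidHom.mk' (fun m => shriekAux S κ m (K.toFun z))
      (fun m m' => by
        induction K.toFun z with
        | zero => simp
        | tmul y x =>
          obtain ⟨x, rfl⟩ := (FrobeniusPushforward.of p R).surjective x
          simp only [shriekAux_tmul, smul_add, map_add, TensorProduct.tmul_add]
        | add y y' hy hy' => simp only [map_add, hy, hy']; abel))
      (fun z z' => by ext m; simp))
    (fun r z m => by
      simp only [AddMonoidHom.mk'_apply, K.map_smul_base]
      induction K.toFun z with
      | zero => simp
      | tmul y x =>
        obtain ⟨x, rfl⟩ := (FrobeniusPushforward.of p R).surjective x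
        simp only [LinearMap.lTensor_tmul, shriekAux_tmul, smul_smul]
        rfl
      | add y y' hy hy' => simp only [map_add, hy, hy'])

theorem shriekAddHom_tmul {p : ℕ} {R S M : Type*} [CommRing R] [CommRing S] [Algebra R S]
    [Fact p.Prime] [CharP R p] [AddCommGroup M] [Module R M] (K : RelCartierOperator p R S)
    (κ : FrobeniusPushforward p R M →ₗ[R] M) (z : relTopForms R S) (m : M) :
    shriekAddHom K κ (z ⊗ₜ[R] m) = shriekAux S κ m (K.toFun z) := rfl

/-- The Cartier structure `F_* f^! M → f^! M` induced by `κ : F_* M → M`. -/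
def shriekCartier {p : ℕ} {R S M : Type*} [CommRing R] [CommRing S] [Algebra R S]
    [Fact p.Prime] [CharP R p] [CharP S p] [AddCommGroup M] [Module R M]
    (K : RelCartierOperator p R S) (κ : FrobeniusPushforward p R M →ₗ[R] M) :
    FrobeniusPushforward p S (ShriekModule R S M) →ₗ[S] ShriekModule R S M where
  toFun w := shriekAddHom K κ ((FrobeniusPushforward.of p S).symm w)
  map_add' w w' := by simp
  map_smul' s w := by
    obtain ⟨w, rfl⟩ := (FrobeniusPushforward.of p S).surjective w
    rw [FrobeniusPushforward.smul_of]
    simp only [AddEquiv.symm_apply_apply, RingHom.id_apply]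
    induction w using TensorProduct.induction_on with
    | zero => simp
    | tmul z m =>
      rw [TensorProduct.smul_tmul', shriekAddHom_tmul, shriekAddHom_tmul, K.map_pow_smul, map_smul]
    | add w w' hw hw' => simp only [smul_add, map_add, hw, hw']

/-- A ring of characteristic `p` is `F`-finite if it is noetherian and its Frobenius is finite. -/
structure IsFFinite (p : ℕ) (R : Type*) [CommRing R] [Fact p.Prime] [CharP R p] : Prop where
  isNoetherianRing : IsNoetherianRing R
  finite : (frobenius R p).Finite

end

/-!
The relative Cartier operator of a smooth morphism is local on `Spec S`. Its domain `F_* ω_f` is a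
finitely presented module, since `S` is `F`-finite, and so existence, uniqueness and finiteness can
all be checked up to a multiple: the elements of `S` by which a statement has to be multiplied in
order to hold form an ideal, and it suffices that this ideal is not contained in any prime
(`Ideal.eq_top_of_forall_exists_notMem`). Around a prime there are coordinates `x₁, …, xₙ` which
make `S` étale over a polynomial ring `B = R[x₁, …, xₙ]` (`FormChart`), and they can be taken
invertible.

*Existence.* The relative Frobenius of an étale algebra is an isomorphism, i.e.
`F_* S = F_* B ⊗[B] S` (`exists_relativeFrobenius_bijective`). Hence the operator on `B` that sends
`r x ^ s dlog x₁ ∧ ⋯ ∧ dlog xₙ` to `x ^ (s / p) dlog x₁ ∧ ⋯ ∧ dlog xₙ ⊗ r`, or to zero if `p` does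
not divide `s`, extends to `S`. It kills exact forms (`logCartier_det`) and sends
`s₁ ^ (p - 1) ds₁ ∧ ⋯ ∧ sₙ ^ (p - 1) dsₙ` to `ds₁ ∧ ⋯ ∧ dsₙ` (`logCartier_prod_pow_mul_det`).

*Uniqueness.* The conditions prescribe the values on `x ^ s dx₁ ∧ ⋯ ∧ dxₙ`, which is exact unless
all `sᵢ` are congruent to `-1` modulo `p`, and these forms generate over `p`-th powers and `R`
(`RelCartierOperator.eq_of_smooth`).

*`F`-regularity.* Let `N` be a Cartier submodule of `W = f^! M` that agrees with `W` generically, so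
that the ideal `J` of the `s ∈ S` with `s W ⊆ N` is not contained in a generic point of the support
of `W`. It suffices that `C₊ (J W) = W` (`plus_smul_top`); for `J = S` this is `F`-purity. Let `I`
be the ideal of `R` generated by the coefficients of the polynomials in the coordinates that lie in
`J` on the chart. Étale morphisms are quasi-finite, and it follows that `I` is not contained in a
generic point of the support of `M` (`FormChart.exists_coeff_notMem`). Hence
`C_{≥ d} (I M) = M` for all `d`, by `F`-regularity of `M`
(`CartierAlgebra.IsFRegular.spanFrom_smul_top`). Finally
`κ^e(x ^ (p ^ e - 1 - γ) g dx₁ ∧ ⋯ ∧ dxₙ ⊗ m) = dx₁ ∧ ⋯ ∧ dxₙ ⊗ κ^e(g_γ m)` for large `e`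
(`FormChart.cartierEnd_pow_coeff`), where `g_γ` is a coefficient of `g`. Thus the `F`-regularity of
`M` gives local generators of `W` in `C₊ (J W)`.
-/

noncomputable section

set_option linter.unusedSectionVars false

/-! ### The relative Frobenius of an étale algebra -/

section RelativeFrobenius

theorem add_pow_of_prime_cast_eq_zero {p : ℕ} (hp : p.Prime) {A : Type*} [CommRing A]
    (h0 : (p : A) = 0) (x y : A) : (x + y) ^ p = x ^ p + y ^ p := by
  have : ExpChar A p ∨ Subsingleton A := by
    rcases subsingleton_or_nontrivial A with h | h
    · exact Or.inr h
    · left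
      have : CharP A p := by
        rcases CharP.exists A with ⟨q, hq⟩
        have h1 : q ∣ p := (CharP.cast_eq_zero_iff A q p).1 h0
        rcases (Nat.dvd_prime hp).1 h1 with rfl | rfl
        · exact absurd rfl (CharP.ringChar_ne_one (R := A) |> fun h => by
            rw [ringChar.eq A 1] at h; exact h)
        · exact hq
      exact ExpChar.prime hp
  rcases this with h | h
  · exact add_pow_expChar _ _ _
  · exact Subsingleton.elim _ _

/-- An unramified algebra of finite type in characteristic `p` all of whose `p`-th powers come from
the base is a quotient of the base. Indeed, the element `t` of `U ⊗ U` witnessing that `U` is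
unramified differs from `1` by an element of the kernel of the multiplication, which is a nil ideal
since `(1 ⊗ u - u ⊗ 1) ^ p = 0`. Hence `t` is a unit, and `t` annihilates all `1 ⊗ u - u ⊗ 1`, so
that `A → U` is a finite epimorphism. -/
theorem surjective_algebraMap_of_unramified_of_pow_mem {p : ℕ} (hp : p.Prime) {A U : Type*}
    [CommRing A] [CommRing U] [Algebra A U] [Algebra.FiniteType A U]
    [Algebra.FormallyUnramified A U] (h0 : (p : U) = 0)
    (h : ∀ u : U, ∃ a : A, algebraMap A U a = u ^ p) :
    Function.Surjective (algebraMap A U) := by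
  have hint : Algebra.IsIntegral A U := ⟨fun u => by
    obtain ⟨a, ha⟩ := h u
    exact IsIntegral.of_pow hp.pos (ha ▸ isIntegral_algebraMap)⟩
  have : Module.Finite A U := Algebra.IsIntegral.finite
  obtain ⟨t, ht, ht1⟩ :=
    (Algebra.FormallyUnramified.iff_exists_tensorProduct (R := A) (S := U)).1 inferInstance
  have h0' : (p : U ⊗[A] U) = 0 := by
    have := congrArg (Algebra.TensorProduct.includeLeft (R := A) (S := A) (A := U) (B := U)) h0
    simpa using this
  have hle : KaehlerDifferential.ideal A U ≤ nilradical (U ⊗[A] U) := by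
    rw [← KaehlerDifferential.span_range_eq_ideal, Ideal.span_le]
    rintro _ ⟨u, rfl⟩
    refine ⟨p, ?_⟩
    have h1 := add_pow_of_prime_cast_eq_zero hp h0' ((1 : U) ⊗ₜ[A] u - u ⊗ₜ[A] (1 : U))
      (u ⊗ₜ[A] (1 : U))
    obtain ⟨a, ha⟩ := h u
    rw [sub_add_cancel, Algebra.TensorProduct.tmul_pow, Algebra.TensorProduct.tmul_pow, one_pow,
      ← ha, Algebra.TensorProduct.tmul_one_eq_one_tmul] at h1
    simpa using h1
  have hu : IsUnit t := by
    have h1 : 1 - t ∈ KaehlerDifferential.ideal A U := by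
      simp only [KaehlerDifferential.ideal, RingHom.mem_ker, map_sub, map_one]
      exact sub_eq_zero.2 ht1.symm
    have h2 : IsNilpotent (1 - t) := hle h1
    simpa using h2.isUnit_one_sub
  have he : ∀ u : U, (1 : U) ⊗ₜ[A] u = u ⊗ₜ[A] (1 : U) := fun u =>
    sub_eq_zero.1 ((hu.mul_left_eq_zero).1 (ht u))
  exact (Algebra.isEpi_iff_surjective_algebraMap_of_finite (R := A) (A := U)).1
    ((Algebra.isEpi_iff_forall_one_tmul_eq A U).2 he)

/-- A morphism of algebras over a noetherian ring, with étale target and unramified source, is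
bijective if it is bijective up to `p`-th powers: it is surjective by
`surjective_algebraMap_of_unramified_of_pow_mem`, and its nilpotent kernel vanishes by infinitesimal
lifting. -/
theorem bijective_of_etale_of_pow_mem {p : ℕ} (hp : p.Prime) {C T U : Type*} [CommRing C]
    [CommRing T] [CommRing U] [Algebra C T] [Algebra C U] [IsNoetherianRing C]
    [Algebra.FiniteType C T] [Algebra.FiniteType C U] [Algebra.FormallyEtale C U]
    [Algebra.FormallyUnramified C T] (π : T →ₐ[C] U)
    (h0 : (p : U) = 0) (hsurj : ∀ u : U, ∃ z : T, π z = u ^ p)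
    (hinj : ∀ z : T, π z = 0 → z ^ p = 0) : Function.Bijective π := by
  have hs : Function.Surjective π := by
    let : Algebra T U := π.toRingHom.toAlgebra
    have : IsScalarTower C T U := IsScalarTower.of_algHom π
    have : Algebra.FiniteType T U := Algebra.FiniteType.of_restrictScalars_finiteType C T U
    have : Algebra.FormallyUnramified T U := Algebra.FormallyUnramified.of_restrictScalars C T U
    exact surjective_algebraMap_of_unramified_of_pow_mem hp (A := T) h0 hsurj
  have : IsNoetherianRing T := Algebra.FiniteType.isNoetherianRing C T
  have hnil : IsNilpotent (RingHom.ker (π : T →+* U)) :=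
    (Ideal.FG.isNilpotent_iff_le_nilradical (IsNoetherian.noetherian _)).2
      fun z hz => ⟨p, hinj z hz⟩
  let σ : U →ₐ[C] T := Algebra.FormallySmooth.liftOfSurjective (AlgHom.id C U) π hs hnil
  have hσ : π.comp σ = AlgHom.id C U := Algebra.FormallySmooth.comp_liftOfSurjective _ _ _ _
  have hσ' : σ.comp π = AlgHom.id C T := by
    refine Algebra.FormallyUnramified.ext _ hnil fun z => ?_
    rw [Ideal.Quotient.eq]
    change π (σ (π z) - z) = 0
    rw [map_sub, sub_eq_zero]
    exact DFunLike.congr_fun hσ (π z)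
  exact ⟨Function.LeftInverse.injective (g := σ) fun z => DFunLike.congr_fun hσ' z, hs⟩

/-- The Frobenius twist of a ring: a copy `A'` of `A`, which is an `A`-algebra through the
Frobenius. -/
def FrobeniusTwist (_p : ℕ) (A : Type*) : Type _ := A

namespace FrobeniusTwist

variable (p : ℕ) (A B S : Type*) [CommRing A] [CommRing B] [CommRing S]

instance : CommRing (FrobeniusTwist p A) := inferInstanceAs (CommRing A)

/-- The identity, as a ring isomorphism `A ≃ A'`. -/
def of : A ≃+* FrobeniusTwist p A := RingEquiv.refl A

instance [Fact p.Prime] [CharP A p] : Algebra A (FrobeniusTwist p A) :=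
  ((of p A).toRingHom.comp (frobenius A p)).toAlgebra

theorem algebraMap_eq [Fact p.Prime] [CharP A p] (a : A) :
    algebraMap A (FrobeniusTwist p A) a = of p A (a ^ p) := rfl

instance [Algebra B S] : Algebra (FrobeniusTwist p B) (FrobeniusTwist p S) :=
  inferInstanceAs (Algebra B S)

theorem algebraMap_of [Algebra B S] (b : B) :
    algebraMap (FrobeniusTwist p B) (FrobeniusTwist p S) (of p B b) = of p S (algebraMap B S b) :=
  rfl

end FrobeniusTwist

open FrobeniusTwist in
/-- The relative Frobenius `B' ⊗[B] S → S'` of an étale `B`-algebra `S` is bijective. -/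
theorem exists_relativeFrobenius_bijective (p : ℕ) [Fact p.Prime] (B S : Type*) [CommRing B]
    [CommRing S] [CharP B p] [CharP S p] [Algebra B S] [IsNoetherianRing B] [Algebra.FiniteType B S]
    [Algebra.FormallyEtale B S] :
    ∃ π : FrobeniusTwist p B ⊗[B] S →+* FrobeniusTwist p S, Function.Bijective π ∧
      ∀ b s, π (of p B b ⊗ₜ[B] s) = of p S (algebraMap B S b * s ^ p) := by
  have hp : p.Prime := Fact.out
  let : Algebra B (FrobeniusTwist p S) :=
    ((algebraMap (FrobeniusTwist p B) (FrobeniusTwist p S)).comp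
      (algebraMap B (FrobeniusTwist p B))).toAlgebra
  have : IsScalarTower B (FrobeniusTwist p B) (FrobeniusTwist p S) := .of_algebraMap_eq fun _ => rfl
  let φ : S →ₐ[B] FrobeniusTwist p S :=
    { (algebraMap S (FrobeniusTwist p S)) with
      commutes' := fun b => by
        change of p S (algebraMap B S b ^ p) = of p S (algebraMap B S (b ^ p))
        rw [map_pow, map_pow, map_pow] }
  have hφ : ∀ s, φ s = of p S (s ^ p) := fun s => rfl
  let π : FrobeniusTwist p B ⊗[B] S →ₐ[FrobeniusTwist p B] FrobeniusTwist p S :=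
    Algebra.TensorProduct.lift (Algebra.ofId _ _) φ (fun _ _ => Commute.all _ _)
  have hπ : ∀ b s, π (of p B b ⊗ₜ[B] s) = of p S (algebraMap B S b * s ^ p) := fun b s => by
    rw [Algebra.TensorProduct.lift_tmul, hφ, Algebra.ofId_apply, algebraMap_of, map_mul]
  have h0 : (p : S) = 0 := CharP.cast_eq_zero S p
  have h0' : (p : FrobeniusTwist p S) = 0 := h0
  have : IsNoetherianRing (FrobeniusTwist p B) := inferInstanceAs (IsNoetherianRing B)
  have : Algebra.FiniteType (FrobeniusTwist p B) (FrobeniusTwist p S) :=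
    inferInstanceAs (Algebra.FiniteType B S)
  have : Algebra.FormallyEtale (FrobeniusTwist p B) (FrobeniusTwist p S) :=
    inferInstanceAs (Algebra.FormallyEtale B S)
  have h0T : (p : FrobeniusTwist p B ⊗[B] S) = 0 := by
    have h2 : (p : FrobeniusTwist p B) = 0 := CharP.cast_eq_zero B p
    have := congrArg (algebraMap (FrobeniusTwist p B) (FrobeniusTwist p B ⊗[B] S)) h2
    simpa using this
  have hpow : ∀ z : FrobeniusTwist p B ⊗[B] S,
      z ^ p = (1 : FrobeniusTwist p B) ⊗ₜ[B] ((of p S).symm (π z)) := by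
    intro z
    induction z with
    | zero => simp [hp.ne_zero]
    | add x y hx hy => rw [add_pow_of_prime_cast_eq_zero hp h0T, hx, hy, map_add, map_add,
        TensorProduct.tmul_add]
    | tmul b s =>
      obtain ⟨b, rfl⟩ := (of p B).surjective b
      rw [hπ, RingEquiv.symm_apply_apply, Algebra.TensorProduct.tmul_pow, ← map_pow,
        ← algebraMap_eq, ← Algebra.smul_def, TensorProduct.tmul_smul, TensorProduct.smul_tmul',
        Algebra.algebraMap_eq_smul_one]
  refine ⟨π.toRingHom, bijective_of_etale_of_pow_mem hp π h0' (fun u => ⟨1 ⊗ₜ (of p S).symm u, ?_⟩)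
    (fun z hz => ?_), hπ⟩
  · have := hπ 1 ((of p S).symm u)
    rw [map_one, map_one, one_mul] at this
    rw [this, map_pow, RingEquiv.apply_symm_apply]
  · rw [hpow, hz, map_zero, TensorProduct.tmul_zero]

open FrobeniusTwist in
/-- An étale `B`-algebra is generated by `B` as a module over its `p`-th powers. -/
theorem closure_pow_mul_algebraMap (p : ℕ) [Fact p.Prime] (B S : Type*) [CommRing B] [CommRing S]
    [CharP B p] [CharP S p] [Algebra B S] [IsNoetherianRing B] [Algebra.FiniteType B S]
    [Algebra.FormallyEtale B S] :
    AddSubgroup.closure {y : S | ∃ (s : S) (b : B), y = s ^ p * algebraMap B S b} = ⊤ := by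
  obtain ⟨π, hπ, hπ'⟩ := exists_relativeFrobenius_bijective p B S
  rw [eq_top_iff]
  intro y _
  obtain ⟨z, hz⟩ := hπ.2 (of p S y)
  obtain rfl : (of p S).symm (π z) = y := by rw [hz, RingEquiv.symm_apply_apply]
  clear hz
  induction z with
  | zero => simp
  | add x y hx hy =>
    rw [map_add, map_add]
    exact add_mem (hx trivial) (hy trivial)
  | tmul b s =>
    obtain ⟨b, rfl⟩ := (of p B).surjective b
    rw [hπ', RingEquiv.symm_apply_apply, mul_comm]
    exact AddSubgroup.subset_closure ⟨s, b, rfl⟩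

open FrobeniusTwist in
/-- An `F⁻¹`-linear map on `B` extends to an `F⁻¹`-linear map on an étale `B`-algebra `S`, since
`F_* S = F_* B ⊗[B] S`. -/
theorem exists_extend_inverse_frobenius_linear (p : ℕ) [Fact p.Prime] {B S E : Type*} [CommRing B]
    [CommRing S] [CharP B p] [CharP S p] [Algebra B S] [IsNoetherianRing B] [Algebra.FiniteType B S]
    [Algebra.FormallyEtale B S] [AddCommGroup E] [Module S E] (θ : B →+ E)
    (hθ : ∀ b b', θ (b ^ p * b') = algebraMap B S b • θ b') :
    ∃ τ : S →+ E, (∀ s y, τ (s ^ p * y) = s • τ y) ∧ ∀ b, τ (algebraMap B S b) = θ b := by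
  obtain ⟨π, hπ, hπ'⟩ := exists_relativeFrobenius_bijective p B S
  let σ : FrobeniusTwist p B ⊗[B] S →+ E := TensorProduct.liftAddHom
    (AddMonoidHom.mk' (fun b => AddMonoidHom.mk' (fun s => s • θ ((of p B).symm b))
      (fun s s' => add_smul _ _ _)) (fun b b' => by ext s; simp))
    (fun c b s => by
      simp only [AddMonoidHom.mk'_apply]
      obtain ⟨b, rfl⟩ := (of p B).surjective b
      rw [Algebra.smul_def, algebraMap_eq, ← map_mul, RingEquiv.symm_apply_apply,
        RingEquiv.symm_apply_apply, hθ, Algebra.smul_def, smul_smul, mul_comm s])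
  have hσ : ∀ b s, σ (of p B b ⊗ₜ s) = s • θ b := fun b s => rfl
  let e : FrobeniusTwist p B ⊗[B] S ≃+* FrobeniusTwist p S := RingEquiv.ofBijective π hπ
  have he : ∀ b s, e.symm (of p S (algebraMap B S b * s ^ p)) = of p B b ⊗ₜ s := fun b s => by
    rw [RingEquiv.symm_apply_eq]
    exact (hπ' b s).symm
  let τ : S →+ E := σ.comp (e.symm.toAddMonoidHom.comp (of p S).toAddMonoidHom)
  have hτ : ∀ y, τ y = σ (e.symm (of p S y)) := fun y => rfl
  refine ⟨τ, fun s y => ?_, fun b => ?_⟩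
  · have hy : y ∈ AddSubgroup.closure
        {y : S | ∃ (s : S) (b : B), y = s ^ p * algebraMap B S b} := by
      rw [closure_pow_mul_algebraMap]; trivial
    induction hy using AddSubgroup.closure_induction with
    | mem y hy =>
      obtain ⟨t, b, rfl⟩ := hy
      rw [← mul_assoc, ← mul_pow, mul_comm _ (algebraMap B S b), mul_comm _ (algebraMap B S b), hτ,
        hτ, he, he, hσ, hσ, mul_smul]
    | zero => simp
    | add x y _ _ hx hy => rw [mul_add, map_add, map_add, hx, hy, smul_add]
    | neg x _ hx => rw [mul_neg, map_neg, map_neg, hx, smul_neg]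
  · have := he b 1
    rw [one_pow, mul_one] at this
    rw [hτ, this, hσ, one_smul]

end RelativeFrobenius

/-! ### The logarithmic Cartier operator in coordinates -/

/-- To prove a statement about families in `A` it suffices to prove it for families in `G`, and to
see that in each single slot it holds for all elements of `A` as soon as it holds for those of
`G`. -/
theorem forall_of_forall_update {ι A : Type*} [Finite ι] [DecidableEq ι] (P : (ι → A) → Prop)
    (G : Set A)
    (h0 : ∀ s, (∀ i, s i ∈ G) → P s)
    (h1 : ∀ s i, (∀ a ∈ G, P (Function.update s i a)) → ∀ a, P (Function.update s i a))
    (s : ι → A) : P s := by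
  have := Fintype.ofFinite ι
  have key : ∀ (t : Finset ι) (s : ι → A), (∀ i ∉ t, s i ∈ G) → P s := by
    intro t
    induction t using Finset.induction_on with
    | empty => exact fun s hs => h0 s fun i => hs i (Finset.notMem_empty i)
    | insert i t _ ih =>
      intro s hs
      rw [← Function.update_eq_self i s]
      refine h1 s i (fun a ha => ih _ fun k hk => ?_) (s i)
      by_cases hki : k = i
      · subst hki; simpa using ha
      · rw [Function.update_of_ne hki]
        exact hs k (by simp [hki, hk])
  exact key Finset.univ s (by simp)

/-- Modulo exact terms, `a ↦ a ^ (p - 1) d a` is additive: the correction term is `d` of the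
integral polynomial `((a + b) ^ p - a ^ p - b ^ p) / p`. No assumption on the characteristic is
needed. -/
theorem Derivation.exists_add_pow_sub {p : ℕ} (hp : p.Prime) {R T : Type*} [CommRing R] [CommRing T]
    [Algebra R T] (d : Derivation R T T) (a b : T) :
    ∃ c : T, (a + b) ^ (p - 1) * d (a + b) = a ^ (p - 1) * d a + b ^ (p - 1) * d b + d c := by
  obtain ⟨q, rfl⟩ : ∃ q, p = q + 1 := ⟨p - 1, by have := hp.pos; omega⟩
  rw [Nat.add_sub_cancel]
  have hc : ∀ j, j < q → ∃ c : ℕ, c * (j + 1) = q.choose j ∧ c * (q - j) = q.choose (j + 1) := by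
    intro j hj
    obtain ⟨c, hc⟩ := hp.dvd_choose_self (k := j + 1) (by omega) (by omega)
    refine ⟨c, Nat.eq_of_mul_eq_mul_left (Nat.succ_pos q) ?_,
      Nat.eq_of_mul_eq_mul_left (Nat.succ_pos q) ?_⟩
    · rw [← mul_assoc, ← hc, Nat.add_one_mul_choose_eq]
    · rw [← mul_assoc, ← hc, mul_comm (q + 1), Nat.choose_mul_succ_eq, Nat.add_sub_add_right]
  choose! c hc1 hc2 using hc
  refine ⟨∑ j ∈ Finset.range q, (c j : T) * (a ^ (j + 1) * b ^ (q - j)), ?_⟩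
  have h1 : (a + b) ^ q = ∑ j ∈ Finset.range q, a ^ j * b ^ (q - j) * (q.choose j : T) + a ^ q := by
    rw [add_pow, Finset.sum_range_succ]; simp
  have h2 : (a + b) ^ q =
      ∑ j ∈ Finset.range q, a ^ (j + 1) * b ^ (q - (j + 1)) * (q.choose (j + 1) : T) + b ^ q := by
    rw [add_pow, Finset.sum_range_succ']; simp
  have h3 : d (∑ j ∈ Finset.range q, (c j : T) * (a ^ (j + 1) * b ^ (q - j))) =
      (∑ j ∈ Finset.range q, a ^ j * b ^ (q - j) * (q.choose j : T)) * d a +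
      (∑ j ∈ Finset.range q, a ^ (j + 1) * b ^ (q - (j + 1)) * (q.choose (j + 1) : T)) * d b := by
    rw [map_sum, Finset.sum_mul, Finset.sum_mul, ← Finset.sum_add_distrib]
    refine Finset.sum_congr rfl fun j hj => ?_
    have hj' := Finset.mem_range.1 hj
    rw [← hc1 j hj', ← hc2 j hj', ← nsmul_eq_mul, map_nsmul, Derivation.leibniz,
      Derivation.leibniz_pow, Derivation.leibniz_pow, Nat.add_sub_cancel, Nat.sub_sub]
    simp only [smul_eq_mul, nsmul_eq_mul]
    push_cast
    ring
  rw [h3, map_add, mul_add]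
  linear_combination (d a) * h1 + (d b) * h2

section Core

variable {p n : ℕ} {R T E : Type*} [CommRing R] [CommRing T] [Algebra R T]
  [Algebra (MvPolynomial (Fin n) R) T] [IsScalarTower R (MvPolynomial (Fin n) R) T]

variable (R T) in
/-- The coordinate functions on `T` given by the variables of the polynomial ring. -/
def coord (i : Fin n) : T := algebraMap (MvPolynomial (Fin n) R) T (MvPolynomial.X i)

/-- The logarithmic derivations `xⱼ ∂ / ∂xⱼ` of an étale algebra over a polynomial ring. -/
theorem exists_logDerivation [Algebra.FormallyEtale (MvPolynomial (Fin n) R) T] :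
    ∃ D : Fin n → Derivation R T T,
      ∀ i j, D j (coord R T i) = if i = j then coord R T i else 0 := by
  let e := KaehlerDifferential.tensorKaehlerEquivOfFormallyEtale R (MvPolynomial (Fin n) R) T
  let b := (KaehlerDifferential.mvPolynomialBasis R (Fin n)).baseChange T
  refine ⟨fun j => (coord R T j) • ((b.coord j) ∘ₗ e.symm.toLinearMap).compDer
    (KaehlerDifferential.D R T), fun i j => ?_⟩
  have h : e.symm (KaehlerDifferential.D R T (coord R T i)) = b i := by
    rw [coord, KaehlerDifferential.tensorKaehlerEquivOfFormallyEtale_symm_D_algebraMap,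
      Module.Basis.baseChange_apply, KaehlerDifferential.mvPolynomialBasis_apply]
  simp [h, Finsupp.single_apply]
  grind

theorem Derivation.eq_zero_of_coord [Algebra.FormallyUnramified (MvPolynomial (Fin n) R) T]
    [AddCommGroup E] [Module T E] [Module R E] [IsScalarTower R T E]
    (d : Derivation R T E) (h : ∀ i, d (coord R T (n := n) i) = 0) : d = 0 := by
  let : Module (MvPolynomial (Fin n) R) E :=
    Module.compHom E (algebraMap (MvPolynomial (Fin n) R) T)
  have : IsScalarTower (MvPolynomial (Fin n) R) T E := .of_algebraMap_smul fun _ _ => rfl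
  have hB : ∀ b : MvPolynomial (Fin n) R, d (algebraMap _ T b) = 0 := by
    intro b
    induction b using MvPolynomial.induction_on with
    | C a => rw [← MvPolynomial.algebraMap_eq, ← IsScalarTower.algebraMap_apply,
        Derivation.map_algebraMap]
    | add b c hb hc => rw [map_add, map_add, hb, hc, add_zero]
    | mul_X b i hb => rw [map_mul, Derivation.leibniz, hb, smul_zero, add_zero]
                      exact (congrArg _ (h i)).trans (smul_zero _)
  let d' : Derivation (MvPolynomial (Fin n) R) T E := Derivation.mk'
    { toFun := d, map_add' := map_add d, map_smul' := fun b t => by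
        rw [Algebra.smul_def, Derivation.leibniz, hB, smul_zero, add_zero]; rfl }
    (fun a b => d.leibniz a b)
  have hsub : Subsingleton (Ω[T⁄MvPolynomial (Fin n) R]) := inferInstance
  ext t
  have : d' t = 0 := by
    rw [← d'.liftKaehlerDifferential_comp_D, Subsingleton.elim (KaehlerDifferential.D _ T t) 0,
      map_zero]
  exact this

theorem logDerivation_monomial {D : Fin n → Derivation R T T}
    (hD : ∀ i j, D j (coord R T i) = if i = j then coord R T i else 0) (j : Fin n)
    (s : Fin n →₀ ℕ) (r : R) :
    D j (algebraMap (MvPolynomial (Fin n) R) T (MvPolynomial.monomial s r)) =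
      s j * algebraMap (MvPolynomial (Fin n) R) T (MvPolynomial.monomial s r) := by
  induction s using Finsupp.induction_linear generalizing r with
  | zero => rw [← MvPolynomial.C_apply, ← MvPolynomial.algebraMap_eq,
      ← IsScalarTower.algebraMap_apply, Derivation.map_algebraMap]; simp
  | add s t hs ht =>
    have h : MvPolynomial.monomial (s + t) r =
        MvPolynomial.monomial s r * MvPolynomial.monomial t (1 : R) := by
      rw [MvPolynomial.monomial_mul, mul_one]
    rw [h, map_mul, Derivation.leibniz, hs, ht]
    simp only [Finsupp.add_apply, smul_eq_mul]
    push_cast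
    ring
  | single i e =>
    have h : MvPolynomial.monomial (Finsupp.single i e) r =
        algebraMap R (MvPolynomial (Fin n) R) r * MvPolynomial.X i ^ e := by
      rw [MvPolynomial.algebraMap_eq, MvPolynomial.C_mul_X_pow_eq_monomial]
    have h' : algebraMap (MvPolynomial (Fin n) R) T (MvPolynomial.monomial (Finsupp.single i e) r) =
        r • coord R T i ^ e := by
      rw [h, map_mul, ← IsScalarTower.algebraMap_apply, map_pow, Algebra.smul_def]; rfl
    rw [h', Derivation.map_smul, Derivation.leibniz_pow, hD]
    rcases eq_or_ne i j with rfl | hij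
    · rcases e with _ | e
      · simp
      · simp only [Finsupp.single_eq_same, Nat.add_sub_cancel, if_true, smul_eq_mul, nsmul_eq_mul]
        simp only [Algebra.smul_def]
        ring
    · simp [hij, Finsupp.single_eq_of_ne (Ne.symm hij)]

variable (R T) in
/-- The monomial `x ^ s` in the coordinate functions. -/
def coordPow (s : Fin n →₀ ℕ) : T :=
  algebraMap (MvPolynomial (Fin n) R) T (MvPolynomial.monomial s 1)

theorem algebraMap_monomial (s : Fin n →₀ ℕ) (r : R) :
    algebraMap (MvPolynomial (Fin n) R) T (MvPolynomial.monomial s r) = r • coordPow R T s := by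
  have h : MvPolynomial.monomial s r =
      algebraMap R (MvPolynomial (Fin n) R) r * MvPolynomial.monomial s 1 := by
    rw [MvPolynomial.algebraMap_eq, MvPolynomial.C_mul_monomial, mul_one]
  rw [h, map_mul, ← IsScalarTower.algebraMap_apply, coordPow, Algebra.smul_def]

theorem coordPow_add (s t : Fin n →₀ ℕ) :
    coordPow R T (s + t) = coordPow R T s * coordPow R T t := by
  rw [coordPow, coordPow, coordPow, ← map_mul, MvPolynomial.monomial_mul, mul_one]

theorem coordPow_zero : coordPow R T (0 : Fin n →₀ ℕ) = 1 := by
  rw [coordPow, MvPolynomial.monomial_zero', map_one, map_one]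

/-- The multi-index `s / p`, rounded down. -/
def divExponent (p : ℕ) (s : Fin n →₀ ℕ) : Fin n →₀ ℕ := s.mapRange (· / p) (Nat.zero_div p)

theorem divExponent_nsmul_add (hp : 0 < p) (s t : Fin n →₀ ℕ) :
    divExponent p (p • s + t) = s + divExponent p t := by
  ext i
  simp [divExponent, Nat.mul_add_div hp]

theorem divExponent_zero : divExponent p (0 : Fin n →₀ ℕ) = 0 := by
  ext i; simp [divExponent]

section

variable [AddCommGroup E] [Module T E]

open Classical in
/-- The logarithmic Cartier operator on the multiples of the monomial `x ^ s`: it sends `r x ^ s` to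
`x ^ (s / p) ε(r)` if `p` divides `s`, and to `0` otherwise. Here `ε` is an `F⁻¹`-linear map, and
`y ∈ T` stands for the form `y dlog x₁ ∧ ⋯ ∧ dlog xₙ`. -/
def logCartierMonomial (p : ℕ) (ε : R →+ E) (s : Fin n →₀ ℕ) : R →+ E :=
  if ∀ i, p ∣ s i then
    (DistribSMul.toAddMonoidHom E (coordPow R T (divExponent p s))).comp ε else 0

variable (T) in
/-- The logarithmic Cartier operator on polynomials, the additive extension of
`logCartierMonomial`. -/
def logCartierPolynomial (p : ℕ) (ε : R →+ E) : MvPolynomial (Fin n) R →+ E where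
  toFun b := (AddMonoidAlgebra.coeff b).sum fun s r => logCartierMonomial (T := T) p ε s r
  map_zero' := by simp
  map_add' b c := by
    rw [AddMonoidAlgebra.coeff_add, Finsupp.sum_add_index' (by simp) (by simp)]

theorem logCartierPolynomial_monomial (ε : R →+ E) (s : Fin n →₀ ℕ) (r : R) :
    logCartierPolynomial T p ε (MvPolynomial.monomial s r) =
      logCartierMonomial (T := T) p ε s r := by
  change Finsupp.sum (Finsupp.single s r) _ = _
  exact Finsupp.sum_single_index (map_zero _)

theorem logCartierPolynomial_pow_mul [Fact p.Prime] [CharP R p] [Module R E] [IsScalarTower R T E]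
    (ε : R →+ E) (hε : ∀ r r', ε (r ^ p * r') = r • ε r') (b b' : MvPolynomial (Fin n) R) :
    logCartierPolynomial T p ε (b ^ p * b') =
      algebraMap (MvPolynomial (Fin n) R) T b • logCartierPolynomial T p ε b' := by
  have hp : p.Prime := Fact.out
  induction b using MvPolynomial.induction_on' with
  | add b c hb hc =>
    rw [add_pow_of_prime_cast_eq_zero hp (CharP.cast_eq_zero _ p), add_mul, map_add, hb, hc,
      map_add, add_smul]
  | monomial s r =>
    induction b' using MvPolynomial.induction_on' with
    | add b c hb hc => rw [mul_add, map_add, hb, hc, map_add, smul_add]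
    | monomial t r' =>
      rw [MvPolynomial.monomial_pow, MvPolynomial.monomial_mul, logCartierPolynomial_monomial,
        logCartierPolynomial_monomial, algebraMap_monomial]
      unfold logCartierMonomial
      by_cases h : ∀ i, p ∣ t i
      · rw [if_pos h, if_pos (fun i => by
          simpa using (Nat.dvd_add_right (dvd_mul_right p _)).2 (h i))]
        simp only [AddMonoidHom.comp_apply, DistribSMul.toAddMonoidHom_apply]
        rw [divExponent_nsmul_add hp.pos, coordPow_add, hε, smul_comm _ r, ← smul_assoc,
          smul_smul, smul_mul_assoc]
      · rw [if_neg h, if_neg]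
        · simp
        · intro h'
          exact h fun i => (Nat.dvd_add_right (dvd_mul_right p _)).1 (by simpa using h' i)

section

variable [Fact p.Prime] [CharP R p] [CharP T p] [IsNoetherianRing R]
  [Algebra.FiniteType (MvPolynomial (Fin n) R) T]
  [Algebra.FormallyEtale (MvPolynomial (Fin n) R) T] [Module R E] [IsScalarTower R T E]

/-- The logarithmic Cartier operator of an étale algebra over the polynomial ring. -/
theorem exists_logCartier (ε : R →+ E) (hε : ∀ r r', ε (r ^ p * r') = r • ε r') :
    ∃ τ : T →+ E, (∀ s y, τ (s ^ p * y) = s • τ y) ∧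
      ∀ s r, τ (r • coordPow R T (n := n) s) = logCartierMonomial (T := T) p ε s r := by
  obtain ⟨τ, h1, h2⟩ := exists_extend_inverse_frobenius_linear p (S := T)
    (logCartierPolynomial (n := n) T p ε) (logCartierPolynomial_pow_mul ε hε)
  refine ⟨τ, h1, fun s r => ?_⟩
  rw [← algebraMap_monomial, h2, logCartierPolynomial_monomial]

variable (p n R T) in
theorem closure_pow_mul_coordPow :
    AddSubgroup.closure {y : T | ∃ (t : T) (r : R) (s : Fin n →₀ ℕ),
      y = t ^ p * r • coordPow R T s} = ⊤ := by
  rw [eq_top_iff, ← closure_pow_mul_algebraMap p (MvPolynomial (Fin n) R) T,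
    AddSubgroup.closure_le]
  rintro _ ⟨t, b, rfl⟩
  induction b using MvPolynomial.induction_on' with
  | add b c hb hc => rw [map_add, mul_add]; exact add_mem hb hc
  | monomial s r =>
    rw [algebraMap_monomial]
    exact AddSubgroup.subset_closure ⟨t, r, s, rfl⟩

variable {ε : R →+ E} {τ : T →+ E} (h1 : ∀ s y, τ (s ^ p * y) = s • τ y)
    (h2 : ∀ s r, τ (r • coordPow R T (n := n) s) = logCartierMonomial (T := T) p ε s r)
include h1 h2

theorem logCartier_smul (r : R) (ρ : E →ₗ[T] E) (hρ : ∀ r', ρ (ε r') = ε (r * r')) (y : T) :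
    τ (r • y) = ρ (τ y) := by
  have hy : y ∈ AddSubgroup.closure {y : T | ∃ (t : T) (r : R) (s : Fin n →₀ ℕ),
      y = t ^ p * r • coordPow R T s} := by rw [closure_pow_mul_coordPow]; trivial
  induction hy using AddSubgroup.closure_induction with
  | mem y hy =>
    obtain ⟨t, r', s, rfl⟩ := hy
    rw [← mul_smul_comm, smul_smul, h1, h1, h2, map_smul, h2]
    unfold logCartierMonomial
    split_ifs with h
    · simp [hρ]
    · simp
  | zero => simp
  | add x y _ _ hx hy => rw [smul_add, map_add, map_add, map_add, hx, hy]
  | neg x _ hx => rw [smul_neg, map_neg, map_neg, map_neg, hx]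

variable {D : Fin n → Derivation R T T}
    (hD : ∀ i j, D j (coord R T i) = if i = j then coord R T i else 0)
include hD

/-- The logarithmic Cartier operator kills exact forms: here `det (Dⱼ sᵢ)` is the coefficient of
`ds₁ ∧ ⋯ ∧ dsₙ` with respect to `dlog x₁ ∧ ⋯ ∧ dlog xₙ`. Slot by slot one reduces to monomials
`sᵢ`, with exponent matrix `N`, where the form is `det N · ∏ sᵢ`. If `p` divides the exponent
of `∏ sᵢ`, then the rows of `N` add up to zero modulo `p`, so that `det N = 0` in `T`. -/
theorem logCartier_det (hn : 0 < n) (s : Fin n → T) :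
    τ (Matrix.det (.of fun i j => D j (s i))) = 0 := by
  have hp : p.Prime := Fact.out
  refine forall_of_forall_update (P := fun s => τ (Matrix.det (.of fun i j => D j (s i))) = 0)
    (G := {y | ∃ (r : R) (t : Fin n →₀ ℕ), y = r • coordPow R T t}) ?_ ?_ s
  · intro s hs
    choose r t hs using hs
    have h3 : (Matrix.of fun i j => D j (s i)) = .of fun i j => s i * (.of fun i j => (t i j : T) :
        Matrix (Fin n) (Fin n) T) i j := by
      ext i j
      simp only [Matrix.of_apply]
      rw [hs i, ← algebraMap_monomial, logDerivation_monomial hD, mul_comm]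
    rw [h3, Matrix.det_mul_column]
    have h4 : ∏ i, s i = (∏ i, r i) • coordPow R T (∑ i, t i) := by
      have : ∀ u : Finset (Fin n), ∏ i ∈ u, s i = (∏ i ∈ u, r i) • coordPow R T (∑ i ∈ u, t i) := by
        intro u
        induction u using Finset.induction_on with
        | empty => simp [coordPow_zero]
        | insert i u hi ih =>
          rw [Finset.prod_insert hi, Finset.prod_insert hi, Finset.sum_insert hi, ih, hs i,
            coordPow_add, smul_mul_smul_comm]
      exact this _
    let N : Matrix (Fin n) (Fin n) ℤ := .of fun i j => (t i j : ℤ)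
    have h5 : (Matrix.det (.of fun i j => (t i j : T) : Matrix (Fin n) (Fin n) T)) =
        ((N.det : ℤ) : T) := by
      have := RingHom.map_det (Int.castRingHom T) N
      rw [← eq_intCast (Int.castRingHom T), this]
      congr 1
      ext i j
      simp [N]
    rw [h5, mul_comm, ← zsmul_eq_mul, map_zsmul, h4, h2]
    unfold logCartierMonomial
    split_ifs with h
    · have h6 : ((N.det : ℤ) : ZMod p) = 0 := by
        have := RingHom.map_det (Int.castRingHom (ZMod p)) N
        rw [← eq_intCast (Int.castRingHom (ZMod p)), this, ← Matrix.exists_vecMul_eq_zero_iff]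
        refine ⟨fun _ => 1, fun h => one_ne_zero (congrFun h ⟨0, hn⟩), ?_⟩
        ext j
        simp only [Matrix.vecMul, dotProduct, one_mul, Pi.zero_apply, N, RingHom.mapMatrix_apply,
          Matrix.map_apply, Matrix.of_apply, map_natCast]
        rw [← Nat.cast_sum, ZMod.natCast_eq_zero_iff]
        simpa using h j
      obtain ⟨k, hk⟩ := (ZMod.intCast_zmod_eq_zero_iff_dvd _ _).1 h6
      have h7 : ∀ x : E, (p : ℤ) • x = 0 := fun x => by
        rw [natCast_zsmul, ← Nat.cast_smul_eq_nsmul T, CharP.cast_eq_zero, zero_smul]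
      rw [hk, mul_smul, h7]
    · simp
  · intro s i hs a
    have ha : a ∈ AddSubgroup.closure {y : T | ∃ (t : T) (r : R) (s : Fin n →₀ ℕ),
      y = t ^ p * r • coordPow R T s} := by rw [closure_pow_mul_coordPow]; trivial
    have h3 : ∀ a, (Matrix.of fun k j => D j (Function.update s i a k)) =
        (Matrix.of fun k j => D j (s k)).updateRow i (fun j => D j a) := by
      intro a
      ext k j
      by_cases hk : k = i
      · subst hk; simp
      · simp [hk]
    simp only [h3] at hs ⊢
    induction ha using AddSubgroup.closure_induction with
    | mem a ha =>
      obtain ⟨t, r, u, rfl⟩ := ha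
      have : (fun j => D j (t ^ p * r • coordPow R T u)) =
          t ^ p • fun j => D j (r • coordPow R T u) := by
        ext j
        rw [Derivation.leibniz, Derivation.leibniz_pow, ← Nat.cast_smul_eq_nsmul T,
          CharP.cast_eq_zero, zero_smul, smul_zero, add_zero, Pi.smul_apply]
      rw [this, Matrix.det_updateRow_smul, h1, hs _ ⟨r, u, rfl⟩, smul_zero]
    | zero =>
      have : (fun j => D j (0 : T)) = (0 : T) • 0 := by ext j; simp
      rw [this, Matrix.det_updateRow_smul, zero_mul, map_zero]
    | add a b _ _ ha hb =>
      have : (fun j => D j (a + b)) = (fun j => D j a) + (fun j => D j b) := by ext j; simp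
      rw [this, Matrix.det_updateRow_add, map_add, ha, hb, add_zero]
    | neg a _ ha =>
      have : (fun j => D j (-a)) = (-1 : T) • (fun j => D j a) := by ext j; simp
      rw [this, Matrix.det_updateRow_smul, neg_one_mul, map_neg, ha, neg_zero]

/-- The logarithmic Cartier operator sends `∏ sᵢ ^ (p - 1) ds₁ ∧ ⋯ ∧ dsₙ` to `ds₁ ∧ ⋯ ∧ dsₙ`. In
each single slot the difference of the two sides is a derivation, so that it is enough to consider
coordinates. -/
theorem logCartier_prod_pow_mul_det (s : Fin n → T) :
    τ ((∏ i, s i ^ (p - 1)) * Matrix.det (.of fun i j => D j (s i))) =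
      Matrix.det (.of fun i j => D j (s i)) • ε 1 := by
  have hp : p.Prime := Fact.out
  have hp1 : p - 1 + 1 = p := Nat.sub_add_cancel hp.one_le
  refine forall_of_forall_update (P := fun s => τ ((∏ i, s i ^ (p - 1)) *
      Matrix.det (.of fun i j => D j (s i))) = Matrix.det (.of fun i j => D j (s i)) • ε 1)
    (G := Set.range (coord (n := n) R T)) ?_ ?_ s
  · intro s hs
    choose σ hσ using hs
    obtain rfl : (fun i => coord R T (σ i)) = s := funext hσ
    have h3 : (Matrix.of fun i j => D j (coord R T (σ i))) = .of fun i j => coord R T (σ i) *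
        (.of fun i j => if σ i = j then 1 else 0 : Matrix (Fin n) (Fin n) T) i j := by
      ext i j
      simp only [Matrix.of_apply]
      rw [hD, mul_ite, mul_one, mul_zero]
    let N : Matrix (Fin n) (Fin n) ℤ := .of fun i j => if σ i = j then 1 else 0
    have h5 : (Matrix.det (.of fun i j => if σ i = j then 1 else 0 : Matrix (Fin n) (Fin n) T)) =
        ((N.det : ℤ) : T) := by
      have := RingHom.map_det (Int.castRingHom T) N
      rw [← eq_intCast (Int.castRingHom T), this]
      congr 1
      ext i j
      by_cases h : σ i = j <;> simp [N, h]
    have h6 : τ 1 = ε 1 := by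
      have := h2 0 1
      rw [one_smul, coordPow_zero] at this
      rw [this]
      simp [logCartierMonomial, divExponent_zero, coordPow_zero]
    rw [h3, Matrix.det_mul_column, h5, ← mul_assoc, Finset.prod_pow, ← pow_succ, hp1, h1,
      ← mul_one ((N.det : ℤ) : T), ← zsmul_eq_mul, map_zsmul, h6, mul_smul, zsmul_eq_mul, mul_one,
      Int.cast_smul_eq_zsmul]
  · intro s i hs a
    have h3 : ∀ a, (Matrix.of fun k j => D j (Function.update s i a k)) =
        (Matrix.of fun k j => D j (s k)).updateRow i (fun j => D j a) := by
      intro a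
      ext k j
      by_cases hk : k = i
      · subst hk; simp
      · simp [hk]
    let w : T := ∏ k ∈ Finset.univ.erase i, s k ^ (p - 1)
    have hw : ∀ a, ∏ k, Function.update s i a k ^ (p - 1) = a ^ (p - 1) * w := by
      intro a
      rw [← Finset.mul_prod_erase _ _ (Finset.mem_univ i), Function.update_self]
      congr 1
      exact Finset.prod_congr rfl fun k hk => by
        rw [Function.update_of_ne (Finset.ne_of_mem_erase hk)]
    let d : Derivation R T T := Derivation.mk'
      { toFun := fun a => ((Matrix.of fun k j => D j (s k)).updateRow i (fun j => D j a)).det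
        map_add' := fun a b => by
          rw [← Matrix.det_updateRow_add]; congr 2; ext j; simp
        map_smul' := fun r a => by
          rw [RingHom.id_apply, ← algebraMap_smul T r (Matrix.det _), smul_eq_mul,
            ← Matrix.det_updateRow_smul]
          congr 2; ext j; simp [Algebra.smul_def] }
      (fun a b => by
        change Matrix.det _ = _ • Matrix.det _ + _ • Matrix.det _
        rw [smul_eq_mul, smul_eq_mul, ← Matrix.det_updateRow_smul, ← Matrix.det_updateRow_smul,
          ← Matrix.det_updateRow_add]
        congr 2; ext j; simp)
    have hd : ∀ a, ((Matrix.of fun k j => D j (s k)).updateRow i (fun j => D j a)).det = d a :=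
      fun a => rfl
    simp only [h3, hw, hd] at hs ⊢
    have hdw : d w = 0 := by
      have : ∀ u : Finset (Fin n), i ∉ u → d (∏ k ∈ u, s k ^ (p - 1)) = 0 := by
        intro u
        induction u using Finset.induction_on with
        | empty => simp
        | insert k u hk ih =>
          intro hi
          rw [Finset.prod_insert hk, Derivation.leibniz, ih (fun h => hi (by simp [h])), smul_zero,
            zero_add, Derivation.leibniz_pow]
          have : d (s k) = 0 := by
            rw [← hd]
            have hki : k ≠ i := fun h => hi (by simp [h])
            refine Matrix.det_zero_of_row_eq hki ?_
            ext j
            simp [Matrix.updateRow_ne hki]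
          rw [this, smul_zero, smul_zero, smul_zero]
      exact this _ (by simp)
    -- `w * d c` comes from an exact form, with `w * c` in the slot `i`
    have hexact : ∀ c, τ (w * d c) = 0 := by
      intro c
      have := logCartier_det h1 h2 hD i.pos (Function.update s i (w * c))
      rwa [h3, hd, Derivation.leibniz, hdw, smul_zero, add_zero] at this
    let F : Derivation R T E := Derivation.mk'
      { toFun := fun a => τ (a ^ (p - 1) * w * d a) - d a • ε 1
        map_add' := fun a b => by
          obtain ⟨c, hc⟩ := d.exists_add_pow_sub hp a b
          have : (a + b) ^ (p - 1) * w * d (a + b) =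
              a ^ (p - 1) * w * d a + b ^ (p - 1) * w * d b + w * d c := by
            linear_combination w * hc
          rw [this, map_add, map_add, hexact, map_add, add_smul]
          abel
        map_smul' := fun r a => by
          rw [RingHom.id_apply, Derivation.map_smul, smul_assoc, smul_sub]
          congr 1
          rw [← algebraMap_smul T r (τ _), ← h1]
          congr 1
          rw [Algebra.smul_def, Algebra.smul_def, mul_pow]
          conv_rhs => rw [← hp1, pow_succ, hp1]
          ring }
      (fun a b => by
        change τ _ - _ = _ • (τ _ - _) + _ • (τ _ - _)
        have : (a * b) ^ (p - 1) * w * d (a * b) =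
            a ^ p * (b ^ (p - 1) * w * d b) + b ^ p * (a ^ (p - 1) * w * d a) := by
          rw [Derivation.leibniz, smul_eq_mul, smul_eq_mul]
          conv_rhs => rw [← hp1, pow_succ, pow_succ, hp1]
          ring
        rw [this, map_add, h1, h1, Derivation.leibniz, add_smul, smul_sub, smul_sub, smul_assoc,
          smul_assoc]
        abel)
    have hF : F = 0 := by
      refine Derivation.eq_zero_of_coord (n := n) F fun k => ?_
      exact sub_eq_zero.2 (hs _ ⟨k, rfl⟩)
    exact sub_eq_zero.1 (DFunLike.congr_fun hF a)

end

end

end Core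

/-! ### Charts for the module of top degree forms -/

section FormallyEtale

variable {n : ℕ} {R S T : Type*} [CommRing R] [CommRing S] [CommRing T] [Algebra R S] [Algebra S T]
  [Algebra R T] [IsScalarTower R S T]

/-- The differential criterion for étaleness, for an `R`-smooth algebra `T` over `B`. -/
theorem formallyEtale_of_bijective_mapBaseChange {B : Type*} [CommRing B] [Algebra R B]
    [Algebra B T] [IsScalarTower R B T] [Algebra.FormallySmooth R T]
    (h : Function.Bijective (KaehlerDifferential.mapBaseChange R B T)) :
    Algebra.FormallyEtale B T := by
  have hsub : Subsingleton (Ω[T⁄B]) := by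
    refine subsingleton_of_forall_eq 0 fun y => ?_
    obtain ⟨y, rfl⟩ := KaehlerDifferential.map_surjective R B T y
    exact (KaehlerDifferential.exact_mapBaseChange_map R B T y).2 (h.2 y)
  have : Algebra.FormallyUnramified B T := ⟨hsub⟩
  have : Algebra.FormallySmooth B T := by
    refine ⟨inferInstance, subsingleton_of_forall_eq 0 fun y => ?_⟩
    have hy : Algebra.H1Cotangent.δ R B T y = 0 := h.1 (by
      rw [map_zero]
      exact (Algebra.H1Cotangent.exact_δ_mapBaseChange R B T _).2 ⟨y, rfl⟩)
    obtain ⟨z, rfl⟩ := (Algebra.H1Cotangent.exact_map_δ R B T y).1 hy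
    rw [Subsingleton.elim z 0, map_zero]
  exact Algebra.FormallyEtale.of_formallyUnramified_and_formallySmooth

end FormallyEtale

/-- Coordinates for the module of relative differentials on the open set where `c` is invertible and
the idempotent `e` is `1`. All conditions are imposed with denominators cleared, over `S` itself;
`e` cuts out the open and closed part of relative dimension `n`. -/
structure FormChart (R S : Type*) [CommRing R] [CommRing S] [Algebra R S] (n : ℕ) where
  /-- The coordinate functions. -/
  x : Fin n → S
  /-- The idempotent of the part of relative dimension `n`. -/
  e : S
  isIdempotentElem_e : IsIdempotentElem e
  /-- The denominator. -/
  c : S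
  /-- The coefficients with respect to the `dxᵢ`, multiplied by `c`. -/
  δ : Ω[S⁄R] →ₗ[S] (Fin n → S)
  δ_D : ∀ i, δ (KaehlerDifferential.D R S (x i)) = Pi.single i c
  smul_eq : ∀ w, c • w = ∑ j, δ w j • KaehlerDifferential.D R S (x j)
  smul_mem : ∀ z ∈ relTopForms R S, e • z ∈ ⋀[S]^n (Ω[S⁄R])
  mem : wedgeForm R e x ∈ relTopForms R S

namespace FormChart

variable {R S : Type*} [CommRing R] [CommRing S] [Algebra R S]

/-- The function whose basic open set is the domain of the chart. The coordinates are made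
invertible as well, in order that logarithmic forms can be used. -/
def f {n : ℕ} (χ : FormChart R S n) : S := χ.e * χ.c * ∏ i, χ.x i

/-- Around a prime, a basis of the differentials at the stalk spreads out to coordinates. -/
theorem exists_coordinates [Algebra.Smooth R S] (P : PrimeSpectrum S) :
    ∃ (x : Fin (Module.rankAtStalk (Ω[S⁄R]) P) → S) (c : S)
      (δ : Ω[S⁄R] →ₗ[S] (Fin (Module.rankAtStalk (Ω[S⁄R]) P) → S)),
      (∀ i, x i ∉ P.asIdeal) ∧ c ∉ P.asIdeal ∧
      (∀ i, δ (KaehlerDifferential.D R S (x i)) = Pi.single i c) ∧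
      ∀ w, c • w = ∑ j, δ w j • KaehlerDifferential.D R S (x j) := by
  let p := P.asIdeal
  obtain ⟨κ, a, b, hb⟩ := Module.exists_basis_of_span_of_flat _
    (KaehlerDifferential.span_range_map_derivation_of_isLocalization R S
      (Localization.AtPrime p) p.primeCompl)
  let l₂ : Ω[S⁄R] →ₗ[S] Ω[Localization.AtPrime p⁄R] :=
    KaehlerDifferential.map R R S (Localization.AtPrime p)
  have : Finite κ := Module.Finite.finite_basis b
  have := Fintype.ofFinite κ
  let ee : LocalizedModule p.primeCompl (Ω[S⁄R]) ≃ₗ[Localization.AtPrime p]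
      Ω[Localization.AtPrime p⁄R] :=
    (IsLocalizedModule.iso p.primeCompl l₂).extendScalarsOfIsLocalization p.primeCompl _
  have hcard : Fintype.card κ = Module.rankAtStalk (Ω[S⁄R]) P := by
    rw [← Module.finrank_eq_card_basis b]
    exact ee.symm.finrank_eq
  generalize Module.rankAtStalk (Ω[S⁄R]) P = n at hcard ⊢
  let σ : κ ≃ Fin n := Fintype.equivFinOfCardEq hcard
  -- a coordinate vanishing at `P` is replaced by its translate by one
  have hx : ∀ y : S, ∃ z ∉ p, KaehlerDifferential.D R S z = KaehlerDifferential.D R S y := by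
    intro y
    by_cases h : y ∈ p
    · exact ⟨y + 1, fun h' => p.one_notMem ((Ideal.add_mem_iff_right p h).1 h'), by simp⟩
    · exact ⟨y, h, rfl⟩
  choose x' hxP' hDx' using hx
  let x : Fin n → S := fun i => x' (a (σ.symm i))
  have hxP : ∀ i, x i ∉ p := fun i => hxP' _
  have hDx : ∀ i, KaehlerDifferential.D R S (x i) = KaehlerDifferential.D R S (a (σ.symm i)) :=
    fun i => hDx' _
  let b' := b.reindex σ
  have hb' : ∀ i, b' i = l₂ (KaehlerDifferential.D R S (x i)) := by
    intro i
    rw [Module.Basis.reindex_apply, hb, hDx]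
    rfl
  let E : (Fin n → S) →ₗ[S] Ω[S⁄R] :=
    Fintype.linearCombination S fun i => KaehlerDifferential.D R S (x i)
  have hE : ∀ v, E v = ∑ j, v j • KaehlerDifferential.D R S (x j) := fun v => rfl
  let l₁ : (Fin n → S) →ₗ[S] (Fin n → Localization.AtPrime p) :=
    LinearMap.pi fun i => Algebra.linearMap S (Localization.AtPrime p) ∘ₗ LinearMap.proj i
  have hl₁ : IsLocalizedModule p.primeCompl l₁ :=
    IsLocalizedModule.pi p.primeCompl fun _ => Algebra.linearMap S (Localization.AtPrime p)
  let ψ : Ω[S⁄R] →ₗ[S] (Fin n → Localization.AtPrime p) :=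
    (b'.equivFun.toLinearMap.restrictScalars S) ∘ₗ l₂
  obtain ⟨h, s, hs⟩ := Module.FinitePresentation.exists_lift_of_isLocalizedModule p.primeCompl l₁ ψ
  have hψ : ∀ v, ψ (E v) = l₁ v := by
    intro v
    simp only [ψ, LinearMap.comp_apply, hE, map_sum, map_smul, ← hb']
    ext i
    simp [l₁, Finsupp.single_apply, Algebra.smul_def]
  have hψ' : ∀ v w, l₁ v = ψ w → l₂ (E v) = l₂ w := by
    intro v w hvw
    apply b'.equivFun.injective
    exact (hψ v).trans hvw
  have h1 : l₁ ∘ₗ (h ∘ₗ E) = l₁ ∘ₗ (s • LinearMap.id) := by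
    rw [← LinearMap.comp_assoc, hs]
    refine LinearMap.ext fun v => ?_
    simp [hψ]
  have h2 : l₂ ∘ₗ (E ∘ₗ h) = l₂ ∘ₗ (s • LinearMap.id) := by
    refine LinearMap.ext fun w => ?_
    refine hψ' _ (s • w) ?_
    have := LinearMap.congr_fun hs w
    simpa using this
  obtain ⟨t₁, ht₁⟩ :=
    Module.Finite.exists_smul_of_comp_eq_of_isLocalizedModule p.primeCompl l₁ _ _ h1
  obtain ⟨t₂, ht₂⟩ :=
    Module.Finite.exists_smul_of_comp_eq_of_isLocalizedModule p.primeCompl l₂ _ _ h2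
  refine ⟨x, t₁ * t₂ * s, ((t₁ * t₂ : p.primeCompl) : S) • h, hxP, (t₁ * t₂ * s).2, fun i => ?_,
    fun w => ?_⟩
  · have := LinearMap.congr_fun ht₁ (Pi.single i 1)
    have hEi : E (Pi.single i 1) = KaehlerDifferential.D R S (x i) := by
      simp [hE, Pi.single_apply]
    simp only [LinearMap.smul_apply, LinearMap.comp_apply, hEi, LinearMap.id_apply] at this
    simp only [Submonoid.smul_def] at this
    rw [LinearMap.smul_apply, Submonoid.coe_mul, mul_comm, mul_smul, this, smul_smul, smul_smul,
      ← Pi.single_smul, smul_eq_mul, mul_one]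
  · have := LinearMap.congr_fun ht₂ w
    simp only [LinearMap.smul_apply, LinearMap.comp_apply, LinearMap.id_apply] at this
    simp only [Submonoid.smul_def] at this
    simp only [LinearMap.smul_apply, Pi.smul_apply, smul_assoc, ← Finset.smul_sum, ← hE]
    rw [Submonoid.coe_mul, mul_smul (t₁ : S) _ (E (h w)), this]
    simp only [mul_smul]

/-- The domains of the charts cover the spectrum of a smooth algebra. -/
theorem exists_f_notMem [Algebra.Smooth R S] (P : PrimeSpectrum S) :
    ∃ (n : ℕ) (χ : FormChart R S n), χ.f ∉ P.asIdeal := by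
  obtain ⟨x, c, δ, hx, hc, hδ, hsmul⟩ := exists_coordinates (R := R) P
  have hlc := Module.isLocallyConstant_rankAtStalk (R := S) (M := Ω[S⁄R])
  generalize hn : Module.rankAtStalk (Ω[S⁄R]) P = n at *
  obtain ⟨e, he, heq⟩ := PrimeSpectrum.isClopen_iff.1 (hlc.isClopen_fiber n)
  have hmem : ∀ Q : PrimeSpectrum S, Module.rankAtStalk (Ω[S⁄R]) Q = n ↔ e ∉ Q.asIdeal := fun Q =>
    Set.ext_iff.1 heq Q
  have he0 : (1 - e) * e = 0 := by rw [sub_mul, one_mul, he.eq, sub_self]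
  have he1 : ∀ Q : PrimeSpectrum S, e ∈ Q.asIdeal → 1 - e ∉ Q.asIdeal := fun Q hQ h =>
    Q.asIdeal.one_notMem (by simpa using add_mem h hQ)
  refine ⟨n, ⟨x, e, he, c, δ, hδ, hsmul, fun z hz => ?_, fun Q => ?_⟩, ?_⟩
  · let I : Ideal S := Submodule.comap (LinearMap.toSpanSingleton S _ (e • z)) (⋀[S]^n (Ω[S⁄R]))
    by_contra hne
    have hI : I ≠ ⊤ := fun h => hne (by
      have h1 : (1 : S) ∈ I := h ▸ Submodule.mem_top
      simpa [I] using h1)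
    obtain ⟨m, hm, hIm⟩ := Ideal.exists_le_maximal I hI
    let Q : PrimeSpectrum S := ⟨m, hm.isPrime⟩
    by_cases hQ : e ∈ m
    · refine he1 Q hQ (hIm ?_)
      simp [I, smul_smul, he0]
    · obtain ⟨s, hs, hsz⟩ := hz Q
      rw [(hmem Q).2 hQ] at hsz
      refine hs (hIm ?_)
      simp only [I, Submodule.mem_comap, LinearMap.toSpanSingleton_apply]
      rw [smul_comm]
      exact Submodule.smul_mem _ _ hsz
  · by_cases hQ : e ∈ Q.asIdeal
    · exact ⟨1 - e, he1 Q hQ, by rw [wedgeForm, smul_smul, he0, zero_smul]; exact zero_mem _⟩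
    · refine ⟨1, Q.asIdeal.one_notMem, ?_⟩
      rw [(hmem Q).2 hQ, one_smul]
      exact Submodule.smul_mem _ _ (exteriorPower.ιMulti _ _ _).2
  · have := P.isPrime
    refine fun h => (this.mem_or_mem h).elim (fun h => (this.mem_or_mem h).elim ?_ hc) fun h => ?_
    · exact (hmem P).1 hn
    · obtain ⟨i, -, hi⟩ := this.prod_mem_iff.1 h
      exact hx i hi

variable {n : ℕ} (χ : FormChart R S n)

section Localization

variable (T : Type*) [CommRing T] [Algebra S T] [Algebra R T] [IsScalarTower R S T]
  [IsLocalization.Away χ.f T]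

/-- The algebra structure on the domain of the chart given by the coordinates. -/
abbrev algebra : Algebra (MvPolynomial (Fin n) R) T :=
  (MvPolynomial.aeval fun i => algebraMap S T (χ.x i)).toAlgebra

theorem isUnit_f : IsUnit (algebraMap S T χ.f) := IsLocalization.Away.algebraMap_isUnit _

theorem isUnit_c : IsUnit (algebraMap S T χ.c) :=
  isUnit_of_dvd_unit (map_dvd _ (by rw [f, mul_comm χ.e, mul_assoc]; exact dvd_mul_right _ _))
    (χ.isUnit_f T)

theorem isUnit_prod : IsUnit (algebraMap S T (∏ i, χ.x i)) :=
  isUnit_of_dvd_unit (map_dvd _ (by rw [f]; exact dvd_mul_left _ _)) (χ.isUnit_f T)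

theorem algebraMap_e : algebraMap S T χ.e = 1 := by
  have h : IsUnit (algebraMap S T χ.e) :=
    isUnit_of_dvd_unit (map_dvd _ (by rw [f, mul_assoc]; exact dvd_mul_right _ _)) (χ.isUnit_f T)
  exact h.mul_left_cancel (by rw [← map_mul, χ.isIdempotentElem_e.eq, mul_one])

theorem isScalarTower :
    letI := χ.algebra T
    IsScalarTower R (MvPolynomial (Fin n) R) T :=
  letI := χ.algebra T
  IsScalarTower.of_algHom (MvPolynomial.aeval fun i => algebraMap S T (χ.x i))

theorem coord_eq (i : Fin n) :
    letI := χ.algebra T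
    coord R T i = algebraMap S T (χ.x i) :=
  MvPolynomial.aeval_X _ i

/-- The coordinates of a chart make its domain étale over affine space. -/
theorem formallyEtale [Algebra.FormallySmooth R S] :
    letI := χ.algebra T
    Algebra.FormallyEtale (MvPolynomial (Fin n) R) T := by
  let := χ.algebra T
  have := χ.isScalarTower T
  have : Algebra.FormallySmooth S T := .of_isLocalization (.powers χ.f)
  have : Algebra.FormallySmooth R T := .comp R S T
  let l₁ : (Fin n → S) →ₗ[S] (Fin n → T) :=
    LinearMap.pi fun i => Algebra.linearMap S T ∘ₗ LinearMap.proj i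
  have hl₁ : IsLocalizedModule (.powers χ.f) l₁ :=
    IsLocalizedModule.pi (.powers χ.f) fun _ => Algebra.linearMap S T
  let δT : Ω[T⁄R] →ₗ[T] (Fin n → T) := IsLocalizedModule.mapExtendScalars (.powers χ.f)
    (KaehlerDifferential.map R R S T) l₁ T χ.δ
  have hδT : ∀ w, δT (KaehlerDifferential.map R R S T w) = l₁ (χ.δ w) := fun w =>
    IsLocalizedModule.map_apply (.powers χ.f) (KaehlerDifferential.map R R S T) l₁ χ.δ w
  let bb := (KaehlerDifferential.mvPolynomialBasis R (Fin n)).baseChange T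
  have hbb : ∀ i, KaehlerDifferential.mapBaseChange R (MvPolynomial (Fin n) R) T (bb i) =
      KaehlerDifferential.map R R S T (KaehlerDifferential.D R S (χ.x i)) := by
    intro i
    rw [Module.Basis.baseChange_apply, KaehlerDifferential.mvPolynomialBasis_apply,
      KaehlerDifferential.mapBaseChange_tmul, one_smul, KaehlerDifferential.map_D,
      KaehlerDifferential.map_D, ← χ.coord_eq T]
    rfl
  have hc := χ.isUnit_c T
  refine formallyEtale_of_bijective_mapBaseChange (R := R) ⟨?_, ?_⟩
  · rw [injective_iff_map_eq_zero]
    intro u hu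
    rw [← bb.sum_repr u, map_sum] at hu
    apply bb.repr.injective
    ext j
    have := congrFun (congrArg δT hu) j
    rw [map_sum, Finset.sum_apply] at this
    simp only [map_smul, hbb, hδT, χ.δ_D] at this
    rw [Finset.sum_eq_single j] at this
    · simpa [l₁, hc.mul_left_eq_zero] using this
    · intro i _ hij
      simp [l₁, hij.symm]
    · simp
  · rw [← LinearMap.range_eq_top, eq_top_iff,
      ← KaehlerDifferential.span_range_map_derivation_of_isLocalization R S T (.powers χ.f),
      Submodule.span_le]
    rintro _ ⟨s, rfl⟩
    change KaehlerDifferential.map R R S T (KaehlerDifferential.D R S s) ∈ _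
    rw [SetLike.mem_coe, ← Submodule.smul_mem_iff_of_isUnit _ hc, algebraMap_smul, ← map_smul,
      χ.smul_eq, map_sum]
    refine Submodule.sum_mem _ fun i _ => ?_
    rw [map_smul, ← hbb, ← algebraMap_smul T]
    exact Submodule.smul_mem _ _ ⟨_, rfl⟩

end Localization

end FormChart
theorem FormChart.finiteType {R S : Type*} [CommRing R] [CommRing S] [Algebra R S] {n : ℕ}
    (χ : FormChart R S n) (T : Type*) [CommRing T] [Algebra S T] [Algebra R T]
    [IsScalarTower R S T] [IsLocalization.Away χ.f T] [Algebra.FiniteType R S] :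
    letI := χ.algebra T
    Algebra.FiniteType (MvPolynomial (Fin n) R) T := by
  let := χ.algebra T
  have := χ.isScalarTower T
  have : Algebra.FiniteType S T := IsLocalization.finiteType_of_monoid_fg (.powers χ.f) T
  have : Algebra.FiniteType R T := Algebra.FiniteType.trans (S := S) inferInstance ‹_›
  exact Algebra.FiniteType.of_restrictScalars_finiteType R _ _

/-! ### The generator of a chart, and finiteness -/

/-- If `c w = ∑ δⱼ(w) yⱼ` for all `w`, then an alternating map on `w₁, …, wₙ` is determined, up to
`c ^ n`, by its value on `y` and the determinant of the coefficients. -/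
theorem AlternatingMap.smul_apply_eq_det_smul {n : ℕ} {S V N : Type*} [CommRing S] [AddCommGroup V]
    [Module S V] [AddCommGroup N] [Module S N] (f : V [⋀^Fin n]→ₗ[S] N) (y : Fin n → V) (c : S)
    (δ : V →ₗ[S] (Fin n → S)) (h : ∀ w, c • w = ∑ j, δ w j • y j) (w : Fin n → V) :
    c ^ n • f w = Matrix.det (.of fun i j => δ (w i) j) • f y := by
  let E : (Fin n → S) →ₗ[S] V := Fintype.linearCombination S y
  have hE : ∀ w, c • w = E (δ w) := h
  let b := Pi.basisFun S (Fin n)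
  have hb : ∀ i, E (b i) = y i := by
    intro i
    simp [E, b, Fintype.linearCombination_apply, Pi.single_apply]
  have key : f.compLinearMap E =
      (LinearMap.toSpanSingleton S N (f y)).compAlternatingMap Matrix.detRowAlternating := by
    refine Module.Basis.ext_alternating b fun v hv => ?_
    let σ : Equiv.Perm (Fin n) := Equiv.ofBijective v (Finite.injective_iff_bijective.1 hv)
    have h1 := (f.compLinearMap E).map_perm b σ
    have h2 := (Matrix.detRowAlternating (R := S) (n := Fin n)).map_perm b σ
    have h3 : Matrix.detRowAlternating (R := S) (n := Fin n) b = 1 := by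
      have : (b : Fin n → Fin n → S) = (1 : Matrix (Fin n) (Fin n) S) := by
        ext i j; simp [b, Matrix.one_apply, Pi.single_apply, eq_comm]
      exact (congrArg Matrix.det this).trans Matrix.det_one
    change (f.compLinearMap E) (b ∘ σ) =
      (Matrix.detRowAlternating (R := S) (n := Fin n) (b ∘ σ)) • f y
    rw [h1, h2, h3]
    simp only [AlternatingMap.compLinearMap_apply, hb]
    rw [Units.smul_def, Units.smul_def, zsmul_eq_mul, mul_one, Int.cast_smul_eq_zsmul]
  have h1 : c ^ n • f w = (f.compLinearMap E) (fun i => δ (w i)) := by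
    rw [AlternatingMap.compLinearMap_apply]
    simp only [← hE]
    have := f.toMultilinearMap.map_smul_univ (fun _ => c) w
    simpa using this.symm
  rw [h1, key]
  rfl

theorem Module.Finite.tensorProduct_of_isScalarTower (R S V N : Type*) [CommRing R]
    [CommRing S] [Algebra R S] [AddCommGroup V] [Module R V] [Module S V] [IsScalarTower R S V]
    [AddCommGroup N] [Module R N]
    [Module.Finite S V] [Module.Finite R N] : Module.Finite S (V ⊗[R] N) :=
  Module.Finite.equiv (TensorProduct.AlgebraTensorModule.cancelBaseChange R S S V N)

/-- A finitely generated algebra over an `F`-finite ring is `F`-finite. -/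
theorem frobenius_finite_of_finiteType (p : ℕ) {R S : Type*} [CommRing R] [CommRing S]
    [Fact p.Prime] [CharP R p] [CharP S p] [Algebra R S] [Algebra.FiniteType R S]
    (h : (frobenius R p).Finite) :
    (frobenius S p).Finite := by
  refine RingHom.Finite.of_isIntegral_of_finiteType ?_ ?_
  · exact fun s => ⟨Polynomial.X ^ p - Polynomial.C s,
      Polynomial.monic_X_pow_sub_C s (Fact.out : p.Prime).ne_zero, by simp [frobenius_def]⟩
  · have hc : (frobenius S p).comp (algebraMap R S) = (algebraMap R S).comp (frobenius R p) := by
      ext r; simp [frobenius_def]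
    have h1 : ((frobenius S p).comp (algebraMap R S)).FiniteType := by
      rw [hc]
      exact RingHom.FiniteType.comp (RingHom.finiteType_algebraMap.2 ‹_›) h.finiteType
    exact RingHom.FiniteType.of_comp_finiteType h1

theorem FrobeniusPushforward.finite (p : ℕ) {S V : Type*} [CommRing S] [Fact p.Prime] [CharP S p]
    [AddCommGroup V] [Module S V] [Module.Finite S V] (h : (frobenius S p).Finite) :
    Module.Finite S (FrobeniusPushforward p S V) := by
  have h1 : Module.Finite S (FrobeniusTwist p S) := h
  let : Module (FrobeniusTwist p S) (FrobeniusPushforward p S V) := inferInstanceAs (Module S V)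
  have : Module.Finite (FrobeniusTwist p S) (FrobeniusPushforward p S V) :=
    inferInstanceAs (Module.Finite S V)
  have : IsScalarTower S (FrobeniusTwist p S) (FrobeniusPushforward p S V) :=
    .of_algebraMap_smul fun _ _ => rfl
  exact Module.Finite.trans (FrobeniusTwist p S) _

namespace FormChart

variable {R S : Type*} [CommRing R] [CommRing S] [Algebra R S] {n : ℕ} (χ : FormChart R S n)

theorem c_pow_mul_e_notMem {P : PrimeSpectrum S} (h : χ.f ∉ P.asIdeal) :
    χ.c ^ n * χ.e ∉ P.asIdeal := fun hce => h <| by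
  rcases P.isPrime.mem_or_mem hce with hc | he
  · exact Ideal.mul_mem_right _ _ (Ideal.mul_mem_left _ _ (P.isPrime.mem_of_pow_mem _ hc))
  · exact Ideal.mul_mem_right _ _ (Ideal.mul_mem_right _ _ he)

/-- The form `e dx₁ ∧ ⋯ ∧ dxₙ`, which generates `ω_f` on the domain of the chart. -/
def gen : relTopForms R S := ⟨wedgeForm R χ.e χ.x, χ.mem⟩

/-- The linear form on the exterior algebra sending `w₁ ∧ ⋯ ∧ wₙ` to `det (δⱼ(wᵢ))`, and
vanishing in all degrees other than `n`. -/
def coeffForm : ExteriorAlgebra S (Ω[S⁄R]) →ₗ[S] S :=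
  ExteriorAlgebra.liftAlternating
    (Pi.single (M := fun i => (Ω[S⁄R]) [⋀^Fin i]→ₗ[S] S) n
      (Matrix.detRowAlternating.compLinearMap χ.δ))

theorem coeffForm_ιMulti (w : Fin n → Ω[S⁄R]) :
    χ.coeffForm (ExteriorAlgebra.ιMulti S n w) = Matrix.det (.of fun i j => χ.δ (w i) j) := by
  rw [coeffForm, ExteriorAlgebra.liftAlternating_apply_ιMulti, Pi.single_eq_same]
  rfl

theorem coeffForm_ιMulti_of_ne {m : ℕ} (hm : m ≠ n) (w : Fin m → Ω[S⁄R]) :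
    χ.coeffForm (ExteriorAlgebra.ιMulti S m w) = 0 := by
  rw [coeffForm, ExteriorAlgebra.liftAlternating_apply_ιMulti, Pi.single_eq_of_ne hm]
  rfl

theorem pow_smul_eq_of_mem {z : ExteriorAlgebra S (Ω[S⁄R])} (hz : z ∈ ⋀[S]^n (Ω[S⁄R])) :
    χ.c ^ n • z = χ.coeffForm z •
      ExteriorAlgebra.ιMulti S n (fun i => KaehlerDifferential.D R S (χ.x i)) := by
  rw [← ExteriorAlgebra.ιMulti_span_fixedDegree] at hz
  induction hz using Submodule.span_induction with
  | mem z hz =>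
    obtain ⟨w, rfl⟩ := hz
    rw [coeffForm_ιMulti]
    exact AlternatingMap.smul_apply_eq_det_smul _ _ _ χ.δ χ.smul_eq w
  | zero => simp
  | add y z _ _ hy hz => rw [smul_add, hy, hz, map_add, add_smul]
  | smul s z _ hz => rw [smul_comm, hz, map_smul, smul_assoc]

/-- A denominator-free form of the statement that `gen` generates `ω_f` on the chart. -/
theorem smul_eq_smul_gen (z : relTopForms R S) :
    (χ.c ^ n * χ.e) • z = χ.coeffForm (χ.e • (z : ExteriorAlgebra S (Ω[S⁄R]))) • χ.gen := by
  ext1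
  have := χ.pow_smul_eq_of_mem (χ.smul_mem z z.2)
  have he : χ.e • χ.e • (z : ExteriorAlgebra S (Ω[S⁄R])) = χ.e • z := by
    rw [smul_smul, χ.isIdempotentElem_e.eq]
  rw [Submodule.coe_smul, Submodule.coe_smul, mul_smul, ← he, smul_comm, this, smul_comm, he]
  rfl

end FormChart

/-- An ideal that meets the complement of each prime is the unit ideal. The ideals in question
consist of the `s ∈ S` for which a statement holds after multiplication by `s`, so that local
statements become global ones without gluing. -/
theorem Ideal.eq_top_of_forall_exists_notMem {S : Type*} [CommRing S] (I : Ideal S)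
    (h : ∀ P : PrimeSpectrum S, ∃ s ∉ P.asIdeal, s ∈ I) : I = ⊤ := by
  by_contra hI
  obtain ⟨m, hm, hIm⟩ := Ideal.exists_le_maximal I hI
  obtain ⟨s, hs, hs'⟩ := h ⟨m, hm.isPrime⟩
  exact hs (hIm hs')

theorem relTopForms_finite (R S : Type*) [CommRing R] [CommRing S] [Algebra R S]
    [Algebra.Smooth R S] : Module.Finite S (relTopForms R S) := by
  let I : Ideal S :=
    { carrier := {c | ∃ N : Submodule S (relTopForms R S), N.FG ∧ ∀ z, c • z ∈ N}
      zero_mem' := ⟨⊥, Submodule.fg_bot, fun z => by simp⟩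
      add_mem' := by
        rintro c c' ⟨N, hN, h⟩ ⟨N', hN', h'⟩
        exact ⟨N ⊔ N', hN.sup hN', fun z => by
          rw [add_smul]
          exact add_mem (Submodule.mem_sup_left (h z)) (Submodule.mem_sup_right (h' z))⟩
      smul_mem' := by
        rintro s c ⟨N, hN, h⟩
        exact ⟨N, hN, fun z => by rw [smul_assoc]; exact N.smul_mem s (h z)⟩ }
  have hI : I = ⊤ := Ideal.eq_top_of_forall_exists_notMem I fun P => by
    obtain ⟨n, χ, hχ⟩ := FormChart.exists_f_notMem (R := R) P
    refine ⟨χ.c ^ n * χ.e, χ.c_pow_mul_e_notMem hχ, Submodule.span S {χ.gen},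
      Submodule.fg_span_singleton _, fun z => ?_⟩
    rw [χ.smul_eq_smul_gen]
    exact Submodule.smul_mem _ _ (Submodule.mem_span_singleton_self _)
  obtain ⟨N, hN, h⟩ : (1 : S) ∈ I := hI ▸ Submodule.mem_top
  have : N = ⊤ := eq_top_iff.2 fun z _ => by simpa using h z
  exact ⟨this ▸ hN⟩

/-! ### Existence of the relative Cartier operator -/

section RelCartierOperator

open FrobeniusPushforward

theorem exists_pow_smul_eq_of_isLocalizedModule {S W E : Type*} [CommRing S] [AddCommGroup W]
    [Module S W] [AddCommGroup E] [Module S E] [IsNoetherian S W] (f : S) (loc : W →ₗ[S] E)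
    [IsLocalizedModule (.powers f) loc] : 
    ∃ k : ℕ, ∀ w w', loc w = loc w' → f ^ k • w = f ^ k • w' := by
  obtain ⟨G, hG⟩ := IsNoetherian.noetherian (LinearMap.ker loc)
  have h : ∀ w, loc w = 0 → ∃ k : ℕ, f ^ k • w = 0 := by
    intro w hw
    obtain ⟨⟨_, k, rfl⟩, hk⟩ := (IsLocalizedModule.eq_zero_iff (.powers f) loc).1 hw
    exact ⟨k, hk⟩
  choose! k hk using h
  refine ⟨G.sup k, fun w w' hww => ?_⟩
  have hw' : w - w' ∈ Submodule.span S (G : Set W) := by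
    rw [hG, LinearMap.mem_ker, map_sub, hww, sub_self]
  have hle : Submodule.span S (G : Set W) ≤ LinearMap.ker (LinearMap.lsmul S W (f ^ G.sup k)) := by
    rw [Submodule.span_le]
    intro y hy
    have hy0 : loc y = 0 := by
      have : y ∈ LinearMap.ker loc := hG ▸ Submodule.subset_span hy
      exact this
    have hle := Finset.le_sup (f := k) hy
    change f ^ G.sup k • y = 0
    rw [← Nat.sub_add_cancel hle, pow_add, mul_smul, hk y hy0, smul_zero]
  have h0 : f ^ G.sup k • (w - w') = 0 := hle hw'
  rwa [smul_sub, sub_eq_zero] at h0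

/-- The properties of `c` times a relative Cartier operator: those of a relative Cartier operator,
with the factor `c` on the right hand side of the normalization `map_log`. -/
structure IsCartierMultiple {p : ℕ} {R S : Type*} [CommRing R] [CommRing S] [Algebra R S]
    [Fact p.Prime] [CharP R p] (c : S)
    (K : relTopForms R S →+ relTopForms R S ⊗[R] FrobeniusPushforward p R R) : Prop where
  map_smul_base : ∀ (r : R) (z : relTopForms R S),
    K (r • z) = (orbitMap p r).lTensor (relTopForms R S) (K z)
  map_pow_smul : ∀ (s : S) (z : relTopForms R S), K (s ^ p • z) = s • K z
  map_exact : ∀ (n : ℕ) (s : Fin n → S) (h : S) (hz : wedgeForm R h s ∈ relTopForms R S),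
    0 < n → K (h ^ (p - 1) • ⟨wedgeForm R h s, hz⟩) = 0
  map_log : ∀ (n : ℕ) (s : Fin n → S) (h : S) (hz : wedgeForm R h s ∈ relTopForms R S),
    K ((h ^ (p - 1) * ∏ i, s i ^ (p - 1)) • ⟨wedgeForm R h s, hz⟩) =
      c • ((⟨wedgeForm R h s, hz⟩ : relTopForms R S) ⊗ₜ[R] of p R (1 : R))

section

variable (p : ℕ) {R S : Type*} [CommRing R] [CommRing S] [Algebra R S] [Fact p.Prime] [CharP R p]

theorem lTensor_smul (r : R) (s : S)
    (w : relTopForms R S ⊗[R] FrobeniusPushforward p R R) :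
    (orbitMap p r).lTensor (relTopForms R S) (s • w) =
      s • (orbitMap p r).lTensor (relTopForms R S) w :=
  (TensorProduct.AlgebraTensorModule.lTensor S (relTopForms R S) (orbitMap p r)).map_smul s w

variable (R S) in
/-- The ideal of all `c` such that `c` times a relative Cartier operator exists. -/
def cartierMultipleIdeal : Ideal S where
  carrier := {c | ∃ K : relTopForms R S →+ relTopForms R S ⊗[R] FrobeniusPushforward p R R,
    IsCartierMultiple c K}
  zero_mem' := ⟨0, by constructor <;> simp⟩
  add_mem' := by
    rintro c c' ⟨K, h⟩ ⟨K', h'⟩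
    refine ⟨K + K', ⟨fun r z => ?_, fun s z => ?_, fun n s g hz hn => ?_, fun n s g hz => ?_⟩⟩
    · simp [h.map_smul_base, h'.map_smul_base]
    · simp [h.map_pow_smul, h'.map_pow_smul]
    · rw [AddMonoidHom.add_apply, h.map_exact n s g hz hn, h'.map_exact n s g hz hn, add_zero]
    · rw [AddMonoidHom.add_apply, h.map_log, h'.map_log, add_smul]
  smul_mem' := by
    rintro a c ⟨K, h⟩
    refine ⟨(DistribSMul.toAddMonoidHom _ a).comp K, ⟨fun r z => ?_, fun s z => ?_,
      fun n s g hz hn => ?_, fun n s g hz => ?_⟩⟩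
    · simp [h.map_smul_base, lTensor_smul]
    · simp [h.map_pow_smul, smul_comm a]
    · rw [AddMonoidHom.comp_apply, h.map_exact n s g hz hn, map_zero]
    · simp only [AddMonoidHom.comp_apply, DistribSMul.toAddMonoidHom_apply]
      rw [h.map_log, smul_eq_mul, mul_smul]

end

theorem IsLocalization.Away.charP (p : ℕ) [Fact p.Prime] {S T : Type*} [CommRing S] [CommRing T]
    [CharP S p] [Algebra S T] {f : S} [IsLocalization.Away f T] {P : PrimeSpectrum S}
    (hP : f ∉ P.asIdeal) : CharP T p := by
  have : Nontrivial T := by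
    refine ⟨1, 0, fun h => ?_⟩
    rw [← map_one (algebraMap S T), IsLocalization.map_eq_zero_iff (.powers f)] at h
    obtain ⟨⟨_, k, rfl⟩, hk⟩ := h
    have hk' : f ^ k = 0 := by simpa using hk
    exact hP (P.isPrime.mem_of_pow_mem k (hk' ▸ zero_mem _))
  have h0 : (p : T) = 0 := by
    rw [← map_natCast (algebraMap S T), CharP.cast_eq_zero, map_zero]
  obtain ⟨q, hq⟩ := CharP.exists T
  rcases (Nat.dvd_prime (Fact.out : p.Prime)).1 ((CharP.cast_eq_zero_iff T q p).1 h0) with rfl | rfl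
  · exact absurd rfl (CharP.char_ne_one T 1)
  · exact hq

namespace FormChart

section LogDerivation

variable {R S : Type*} [CommRing R] [CommRing S] [Algebra R S] {n : ℕ} (χ : FormChart R S n)
  (T : Type*) [CommRing T] [Algebra S T] [Algebra R T] [IsScalarTower R S T]
  [IsLocalization.Away χ.f T]

theorem logDerivation_algebraMap {D : Fin n → Derivation R T T}
    (hD : ∀ i j, D j (algebraMap S T (χ.x i)) = if i = j then algebraMap S T (χ.x i) else 0)
    (j : Fin n) (s : S) :
    algebraMap S T χ.c * D j (algebraMap S T s) =
      algebraMap S T (χ.x j) * algebraMap S T (χ.δ (KaehlerDifferential.D R S s) j) := by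
  let d : Derivation R S T := (D j).compAlgebraMap S
  have hd : ∀ s, d.liftKaehlerDifferential (KaehlerDifferential.D R S s) =
      D j (algebraMap S T s) := fun s => d.liftKaehlerDifferential_comp_D s
  have h := congrArg d.liftKaehlerDifferential (χ.smul_eq (KaehlerDifferential.D R S s))
  simp only [map_smul, map_sum, hd, hD, smul_ite, smul_zero] at h
  rw [Finset.sum_ite_eq' Finset.univ j, if_pos (Finset.mem_univ j)] at h
  rw [← Algebra.smul_def, h, Algebra.smul_def, mul_comm]

theorem det_logDerivation {D : Fin n → Derivation R T T}
    (hD : ∀ i j, D j (algebraMap S T (χ.x i)) = if i = j then algebraMap S T (χ.x i) else 0)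
    (s : Fin n → S) :
    algebraMap S T χ.c ^ n * Matrix.det (.of fun i j => D j (algebraMap S T (s i))) =
      algebraMap S T (∏ i, χ.x i) * algebraMap S T
        (Matrix.det (.of fun i j => χ.δ (KaehlerDifferential.D R S (s i)) j)) := by
  have h1 := Matrix.det_smul (.of fun i j => D j (algebraMap S T (s i)) :
    Matrix (Fin n) (Fin n) T) (algebraMap S T χ.c)
  rw [Fintype.card_fin] at h1
  rw [← h1, RingHom.map_det, map_prod, ← Matrix.det_mul_row]
  congr 1
  ext i j
  simpa using χ.logDerivation_algebraMap T hD j (s i)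

end LogDerivation

variable {p : ℕ} [Fact p.Prime] {R S : Type*} [CommRing R] [CharP R p] [CommRing S] [CharP S p]
  [Algebra R S] [Algebra.Smooth R S] {n : ℕ} (χ : FormChart R S n)

section

variable {T E : Type*} [CommRing T] [CharP T p] [Algebra S T] [Algebra R T] [IsScalarTower R S T]
  [IsLocalization.Away χ.f T] [AddCommGroup E] [Module S E] [Module T E] [IsScalarTower S T E]

include χ in
/-- The relative Cartier operator on the domain of a chart, as a map from the forms on all of
`Spec S` to a localization `E` of its target, with localization map `loc`. It is the logarithmic
Cartier operator applied to the coefficient of a form with respect to `dlog x₁ ∧ ⋯ ∧ dlog xₙ`.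
Linearity over `F_* R` is phrased by means of an endomorphism `ρ` of `E` that extends the
multiplication by `r`. -/
theorem exists_localCartier [IsNoetherianRing R]
    (loc : relTopForms R S ⊗[R] FrobeniusPushforward p R R →ₗ[S] E) :
    ∃ κ : relTopForms R S →+ E, (∀ (s : S) z, κ (s ^ p • z) = s • κ z) ∧
      (∀ (r : R) (ρ : E →ₗ[T] E),
        (∀ w, ρ (loc w) = loc ((orbitMap p r).lTensor (relTopForms R S) w)) →
        ∀ z, κ (r • z) = ρ (κ z)) ∧
      (∀ (m : ℕ) (s : Fin m → S) (h : S) (hz : wedgeForm R h s ∈ relTopForms R S),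
        0 < m → κ (h ^ (p - 1) • ⟨wedgeForm R h s, hz⟩) = 0) ∧
      (∀ (m : ℕ) (s : Fin m → S) (h : S) (hz : wedgeForm R h s ∈ relTopForms R S),
        κ ((h ^ (p - 1) * ∏ i, s i ^ (p - 1)) • ⟨wedgeForm R h s, hz⟩) =
          loc ((⟨wedgeForm R h s, hz⟩ : relTopForms R S) ⊗ₜ[R] of p R (1 : R))) := by
  have hp : p.Prime := Fact.out
  let : Module R E := Module.compHom E (algebraMap R T)
  have : IsScalarTower R T E := .of_algebraMap_smul fun _ _ => rfl
  have hRS : ∀ (r : R) (y : E), r • y = algebraMap R S r • y := fun r y => by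
    rw [← algebraMap_smul T r y, ← algebraMap_smul T (algebraMap R S r) y,
      ← IsScalarTower.algebraMap_apply]
  let := χ.algebra T
  have := χ.isScalarTower T
  have := χ.formallyEtale T
  have := χ.finiteType T
  obtain ⟨u, hu⟩ := χ.isUnit_prod T
  obtain ⟨c, hc⟩ := χ.isUnit_c T
  have he := χ.algebraMap_e T
  let ε : R →+ E :=
    { toFun := fun r => (↑u⁻¹ : T) • loc (χ.gen ⊗ₜ[R] of p R r)
      map_zero' := by simp
      map_add' := fun r r' => by simp [TensorProduct.tmul_add] }
  have hε : ∀ r, ε r = (↑u⁻¹ : T) • loc (χ.gen ⊗ₜ[R] of p R r) := fun r => rfl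
  obtain ⟨τ, h1, h2⟩ := exists_logCartier (p := p) (n := n) (T := T) ε (fun r r' => by
    rw [hε, hε, ← smul_eq_mul, ← FrobeniusPushforward.smul_of, TensorProduct.tmul_smul,
      ← algebraMap_smul S r, map_smul, hRS, smul_comm])
  obtain ⟨D, hD⟩ := exists_logDerivation (n := n) (R := R) (T := T)
  have hD' : ∀ i j, D j (algebraMap S T (χ.x i)) =
      if i = j then algebraMap S T (χ.x i) else 0 := fun i j => by
    rw [← χ.coord_eq]; exact hD i j
  -- the coefficient with respect to `dlog x₁ ∧ ⋯ ∧ dlog xₙ`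
  let coeff : relTopForms R S →ₗ[S] T :=
    ((↑(c ^ n)⁻¹ * ↑u : T) • Algebra.linearMap S T) ∘ₗ χ.coeffForm ∘ₗ
      (χ.e • (relTopForms R S).subtype)
  have hcoeff : ∀ z, coeff z = (↑(c ^ n)⁻¹ * ↑u) * algebraMap S T (χ.coeffForm (χ.e • z)) :=
    fun z => rfl
  have hw : ∀ (s : Fin n → S) (h : S) (hz : wedgeForm R h s ∈ relTopForms R S),
      coeff ⟨wedgeForm R h s, hz⟩ =
        algebraMap S T h * Matrix.det (.of fun i j => D j (algebraMap S T (s i))) := by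
    intro s h hz
    rw [hcoeff]
    simp only [wedgeForm, map_smul, smul_eq_mul, map_mul, he, one_mul]
    rw [χ.coeffForm_ιMulti]
    have h3 := χ.det_logDerivation T hD' s
    rw [← hc, ← hu] at h3
    rw [mul_left_comm, mul_assoc, ← h3, ← Units.val_pow_eq_pow_val, Units.inv_mul_cancel_left]
  have hw0 : ∀ (m : ℕ) (s : Fin m → S) (h : S) (hz : wedgeForm R h s ∈ relTopForms R S),
      m ≠ n → coeff ⟨wedgeForm R h s, hz⟩ = 0 := by
    intro m s h hz hm
    rw [hcoeff]
    simp only [wedgeForm, map_smul]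
    rw [χ.coeffForm_ιMulti_of_ne hm, smul_zero, smul_zero, map_zero, mul_zero]
  let κ : relTopForms R S →+ E := τ.comp coeff.toAddMonoidHom
  have hκ : ∀ z, κ z = τ (coeff z) := fun z => rfl
  refine ⟨κ, fun s z => ?_, fun r ρ hρ z => ?_, fun m s h hz hm => ?_, fun m s h hz => ?_⟩
  · rw [hκ, hκ, map_smul, Algebra.smul_def, map_pow, h1, algebraMap_smul]
  · rw [hκ, hκ, ← algebraMap_smul S r z, map_smul, algebraMap_smul]
    refine logCartier_smul h1 h2 r ρ (fun r' => ?_) _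
    rw [hε, map_smul, hρ, hε, LinearMap.lTensor_tmul, mul_comm]
    rfl
  · rw [hκ, map_smul]
    rcases eq_or_ne m n with rfl | hmn
    · rw [hw, Algebra.smul_def, ← mul_assoc, ← map_mul, ← pow_succ, Nat.sub_add_cancel hp.one_le,
        map_pow, h1, logCartier_det h1 h2 hD hm, smul_zero]
    · rw [hw0 m s h hz hmn, smul_zero, map_zero]
  · rw [hκ, map_smul]
    -- `gen` generates `ω_f` on the chart, so `loc (z ⊗ 1)` is determined by the coefficient of `z`
    have hloc : ∀ z : relTopForms R S, loc (z ⊗ₜ[R] of p R (1 : R)) = coeff z • ε 1 := by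
      intro z
      have h3 : ((↑(c ^ n) : T)) • loc (z ⊗ₜ[R] of p R (1 : R)) =
          algebraMap S T (χ.coeffForm (χ.e • z)) • loc (χ.gen ⊗ₜ[R] of p R (1 : R)) := by
        rw [algebraMap_smul, ← map_smul loc, TensorProduct.smul_tmul', ← χ.smul_eq_smul_gen,
          ← TensorProduct.smul_tmul', map_smul loc, ← algebraMap_smul T (χ.c ^ n * χ.e), map_mul,
          he, mul_one, map_pow, Units.val_pow_eq_pow_val, hc]
      rw [hε, hcoeff, smul_smul, mul_right_comm, Units.mul_inv_cancel_right, mul_smul, ← h3,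
        smul_smul, Units.inv_mul, one_smul]
    rw [hloc]
    rcases eq_or_ne m n with rfl | hmn
    · have h3 := logCartier_prod_pow_mul_det h1 h2 hD (fun i => algebraMap S T (s i))
      have h4 : (h ^ (p - 1) * ∏ i, s i ^ (p - 1)) • coeff ⟨wedgeForm R h s, hz⟩ =
          algebraMap S T h ^ p * ((∏ i, algebraMap S T (s i) ^ (p - 1)) *
            Matrix.det (.of fun i j => D j (algebraMap S T (s i)))) := by
        rw [hw, Algebra.smul_def, map_mul, map_prod, map_pow]
        simp only [map_pow]
        conv_rhs => rw [← Nat.sub_add_cancel hp.one_le, pow_succ, Nat.sub_add_cancel hp.one_le]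
        ring
      rw [h4, h1, h3, hw, mul_smul]
    · rw [hw0 m s h hz hmn, smul_zero, map_zero, zero_smul]

end

/-- The local operator, multiplied by a power of `f`, is defined on all of `Spec S`: `F_* ω_f` is
finitely presented, since `S` is `F`-finite, so that the operator lifts up to a power of `f`, and
a further power of `f` kills the `f`-torsion, where the required identities may fail. -/
theorem exists_isCartierMultiple (hR : IsFFinite p R) (P : PrimeSpectrum S) (hP : χ.f ∉ P.asIdeal) :
    ∃ (k : ℕ) (K : relTopForms R S →+ relTopForms R S ⊗[R] FrobeniusPushforward p R R),
      IsCartierMultiple (χ.f ^ k) K := by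
  have hp : p.Prime := Fact.out
  have := hR.isNoetherianRing
  have : IsNoetherianRing S := Algebra.FiniteType.isNoetherianRing R S
  have := relTopForms_finite R S
  have : Module.Finite R (FrobeniusPushforward p R R) := hR.finite
  have hWfin : Module.Finite S (relTopForms R S ⊗[R] FrobeniusPushforward p R R) :=
    Module.Finite.tensorProduct_of_isScalarTower R S _ _
  have : Module.Finite S (FrobeniusPushforward p S (relTopForms R S)) :=
    FrobeniusPushforward.finite p (frobenius_finite_of_finiteType p hR.finite)
  have : Module.FinitePresentation S (FrobeniusPushforward p S (relTopForms R S)) :=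
    Module.finitePresentation_of_finite S _
  have : CharP (Localization.Away χ.f) p := IsLocalization.Away.charP p hP
  let loc := TensorProduct.mk S (Localization.Away χ.f)
    (relTopForms R S ⊗[R] FrobeniusPushforward p R R) 1
  have : IsLocalizedModule (.powers χ.f) loc :=
    (isLocalizedModule_iff_isBaseChange (.powers χ.f) (Localization.Away χ.f) loc).2
      (TensorProduct.isBaseChange S _ _)
  obtain ⟨κ, h1, h2, h3, h4⟩ := χ.exists_localCartier (T := Localization.Away χ.f) loc
  let κ' : FrobeniusPushforward p S (relTopForms R S) →ₗ[S]
      Localization.Away χ.f ⊗[S] (relTopForms R S ⊗[R] FrobeniusPushforward p R R) :=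
    { toFun := fun z => κ ((of p S).symm z)
      map_add' := fun z z' => by simp
      map_smul' := fun s z => by
        obtain ⟨z, rfl⟩ := (of p S).surjective z
        rw [FrobeniusPushforward.smul_of, AddEquiv.symm_apply_apply, h1]; rfl }
  obtain ⟨K, ⟨_, k, rfl⟩, hK⟩ := Module.FinitePresentation.exists_lift_of_isLocalizedModule
    (N := relTopForms R S ⊗[R] FrobeniusPushforward p R R)
    (.powers χ.f) loc κ'
  have hK' : ∀ z, loc (K (of p S z)) = χ.f ^ k • κ z := fun z => LinearMap.congr_fun hK (of p S z)
  have : IsNoetherian S (relTopForms R S ⊗[R] FrobeniusPushforward p R R) :=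
    isNoetherian_of_isNoetherianRing_of_finite S
      (relTopForms R S ⊗[R] FrobeniusPushforward p R R)
  -- an identity that holds after localization holds after multiplication by `f ^ N`
  obtain ⟨N, hN'⟩ := exists_pow_smul_eq_of_isLocalizedModule
    (W := relTopForms R S ⊗[R] FrobeniusPushforward p R R) χ.f loc
  let K' : relTopForms R S →+ relTopForms R S ⊗[R] FrobeniusPushforward p R R :=
    { toFun := fun z => χ.f ^ N • K (of p S z)
      map_zero' := by simp
      map_add' := fun z z' => by simp }
  have hK'' : ∀ z, K' z = χ.f ^ N • K (of p S z) := fun z => rfl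
  refine ⟨N + k, K', ⟨fun r z => ?_, fun s z => ?_, fun m s h hz hm => ?_, fun m s h hz => ?_⟩⟩
  · rw [hK'', hK'', lTensor_smul]
    refine hN' _ _ ?_
    let ρ := IsLocalizedModule.mapExtendScalars (.powers χ.f) loc loc (Localization.Away χ.f)
      (TensorProduct.AlgebraTensorModule.lTensor S (relTopForms R S) (orbitMap p r))
    have hρ : ∀ w, ρ (loc w) = loc ((orbitMap p r).lTensor (relTopForms R S) w) := fun w =>
      IsLocalizedModule.map_apply (.powers χ.f) loc loc _ w
    rw [← hρ, hK', hK', h2 r ρ hρ]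
    exact (ρ.map_smul_of_tower (χ.f ^ k) (κ z)).symm
  · rw [hK'', hK'', ← FrobeniusPushforward.smul_of, map_smul, smul_comm]
  · rw [hK'', hN' _ 0, smul_zero]
    rw [hK', h3 m s h hz hm, smul_zero, map_zero]
  · rw [hK'', pow_add]
    refine (hN' _ (χ.f ^ k • _) ?_).trans (mul_smul _ _ _).symm
    rw [hK', h4, map_smul]

end FormChart

theorem exists_relCartierOperator {p : ℕ} [Fact p.Prime] {R S : Type*} [CommRing R] [CharP R p]
    (hR : IsFFinite p R) [CommRing S] [CharP S p] [Algebra R S] [Algebra.Smooth R S] :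
    Nonempty (RelCartierOperator p R S) := by
  have hI : cartierMultipleIdeal p R S = ⊤ := Ideal.eq_top_of_forall_exists_notMem _ fun P => by
    obtain ⟨n, χ, hχ⟩ := FormChart.exists_f_notMem (R := R) P
    obtain ⟨k, hk⟩ := χ.exists_isCartierMultiple hR P hχ
    exact ⟨χ.f ^ k, fun h => hχ (P.isPrime.mem_of_pow_mem _ h), hk⟩
  obtain ⟨K, hK⟩ : (1 : S) ∈ cartierMultipleIdeal p R S := hI ▸ Submodule.mem_top
  exact ⟨⟨K, hK.map_smul_base, hK.map_pow_smul, hK.map_exact, fun n s h hz => by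
    rw [hK.map_log, one_smul]⟩⟩

/-! ### Uniqueness of the relative Cartier operator -/

namespace FormChart

section

variable {R S : Type*} [CommRing R] [CommRing S] [Algebra R S] {n : ℕ} (χ : FormChart R S n)

/-- The monomial `∏ i, xᵢ ^ sᵢ` in the coordinates of a chart. -/
def monomial (s : Fin n → ℕ) : S := ∏ i, χ.x i ^ s i

theorem monomial_add (s s' : Fin n → ℕ) :
    χ.monomial (s + s') = χ.monomial s * χ.monomial s' := by
  simp [monomial, pow_add, Finset.prod_mul_distrib]

theorem monomial_nsmul (k : ℕ) (s : Fin n → ℕ) : χ.monomial (k • s) = χ.monomial s ^ k := by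
  simp [monomial, Finset.prod_pow, pow_mul, mul_comm k]

theorem aeval_monomial (s : Fin n →₀ ℕ) (r : R) :
    MvPolynomial.aeval χ.x (MvPolynomial.monomial s r) = r • χ.monomial s := by
  rw [MvPolynomial.aeval_monomial, Algebra.smul_def, monomial, Finsupp.prod_fintype]
  simp

theorem e_smul_gen : χ.e • χ.gen = χ.gen := by
  ext1
  change χ.e • (χ.e • _) = χ.e • _
  rw [smul_smul, χ.isIdempotentElem_e.eq]

/-- Replacing the slot `xᵢ` of `dx₁ ∧ ⋯ ∧ dxₙ` by `x ^ s * xᵢ` multiplies the form by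
`(sᵢ + 1) x ^ s`. -/
theorem wedgeForm_update (s : Fin n → ℕ) (i : Fin n) :
    wedgeForm R χ.e (Function.update χ.x i (χ.monomial s * χ.x i)) =
      (s i + 1) • χ.monomial s • (χ.gen : ExteriorAlgebra S (Ω[S⁄R])) := by
  let l := (ExteriorAlgebra.ιMulti S (M := Ω[S⁄R]) n).toMultilinearMap.toLinearMap
    (fun i => KaehlerDifferential.D R S (χ.x i)) i
  let d : Derivation R S (ExteriorAlgebra S (Ω[S⁄R])) := l.compDer (KaehlerDifferential.D R S)
  have hd : ∀ y, d y = ExteriorAlgebra.ιMulti S n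
      (fun k => KaehlerDifferential.D R S (Function.update χ.x i y k)) := by
    intro y
    change ExteriorAlgebra.ιMulti S n (Function.update _ i _) = _
    congr 1
    ext1 k
    rcases eq_or_ne k i with rfl | h
    · simp
    · simp [h]
  have hd0 : ∀ j, j ≠ i → d (χ.x j) = 0 := by
    intro j hj
    rw [hd]
    exact (ExteriorAlgebra.ιMulti S n).map_eq_zero_of_eq _ (by simp [hj]) hj
  have hprod : d (∏ j ∈ Finset.univ.erase i, χ.x j ^ s j) = 0 := by
    refine Finset.prod_induction _ (fun y => d y = 0) (fun y y' h h' => ?_) d.map_one_eq_zero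
      (fun j hj => ?_)
    · rw [d.leibniz, h, h', smul_zero, smul_zero, add_zero]
    · rw [d.leibniz_pow, hd0 j (Finset.ne_of_mem_erase hj), smul_zero, smul_zero]
  have hm : χ.monomial s = χ.x i ^ s i * ∏ j ∈ Finset.univ.erase i, χ.x j ^ s j :=
    (Finset.mul_prod_erase _ _ (Finset.mem_univ i)).symm
  have hi : d (χ.x i) = ExteriorAlgebra.ιMulti S n
      (fun k => KaehlerDifferential.D R S (χ.x k)) := by
    rw [hd, Function.update_eq_self]
  change χ.e • ExteriorAlgebra.ιMulti S n (fun k => KaehlerDifferential.D R S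
      (Function.update χ.x i (χ.monomial s * χ.x i) k)) = (s i + 1) • χ.monomial s • χ.e •
    ExteriorAlgebra.ιMulti S n (fun k => KaehlerDifferential.D R S (χ.x k))
  rw [← hd, ← hi, smul_comm (χ.monomial s), smul_comm (s i + 1)]
  congr 1
  have h2 : χ.monomial s * χ.x i =
      (∏ j ∈ Finset.univ.erase i, χ.x j ^ s j) * χ.x i ^ (s i + 1) := by
    rw [hm]; ring
  rw [h2, d.leibniz, hprod, smul_zero, add_zero, d.leibniz_pow, Nat.add_sub_cancel, smul_comm,
    smul_smul, hm, mul_comm]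

end

variable {p : ℕ} [Fact p.Prime] {R S : Type*} [CommRing R] [CharP R p] [CommRing S] [CharP S p]
  [Algebra R S] {n : ℕ} (χ : FormChart R S n)

theorem pow_smul_gen (k : ℕ) (hk : k ≠ 0) : χ.e ^ k • χ.gen = χ.gen := by
  rw [χ.isIdempotentElem_e.pow_eq hk, e_smul_gen]

/-- If `p ∤ sᵢ + 1`, then `x ^ s dx₁ ∧ ⋯ ∧ dxₙ` is exact. -/
theorem toFun_monomial_smul_gen_eq_zero (K : RelCartierOperator p R S) {s : Fin n → ℕ} {i : Fin n}
    (hi : ¬ p ∣ s i + 1) : K.toFun (χ.monomial s • χ.gen) = 0 := by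
  have hp : p.Prime := Fact.out
  have hw := χ.wedgeForm_update (R := R) s i
  have hz : wedgeForm R χ.e (Function.update χ.x i (χ.monomial s * χ.x i)) ∈ relTopForms R S := by
    rw [hw]
    exact nsmul_mem ((relTopForms R S).smul_mem _ χ.gen.2) _
  have h := K.map_exact n _ χ.e hz i.pos
  have heq : (⟨_, hz⟩ : relTopForms R S) = (s i + 1) • χ.monomial s • χ.gen := by
    ext1
    exact hw
  rw [heq, smul_comm, smul_comm (χ.e ^ (p - 1)), pow_smul_gen _ _ (Nat.sub_ne_zero_of_lt hp.one_lt),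
    map_nsmul] at h
  have h' : p • K.toFun (χ.monomial s • χ.gen) = 0 := by
    rw [← Nat.cast_smul_eq_nsmul S, CharP.cast_eq_zero, zero_smul]
  rw [← addOrderOf_dvd_iff_nsmul_eq_zero] at h h'
  have := Nat.dvd_gcd h' h
  rw [(Nat.Prime.coprime_iff_not_dvd hp).2 hi, Nat.dvd_one, AddMonoid.addOrderOf_eq_one_iff] at this
  exact this

theorem toFun_monomial_smul_gen (K : RelCartierOperator p R S) {s ν : Fin n → ℕ}
    (h : ∀ i, s i + 1 = p * (ν i + 1)) :
    K.toFun (χ.monomial s • χ.gen) = (χ.monomial ν • χ.gen) ⊗ₜ[R] of p R (1 : R) := by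
  have hp : p.Prime := Fact.out
  have hs : s = p • ν + fun _ => p - 1 := by
    ext i
    have h1 := h i
    have h2 := hp.one_lt
    simp only [Pi.add_apply, Pi.smul_apply, smul_eq_mul]
    rw [mul_add, mul_one] at h1
    omega
  have h1 := K.map_log n χ.x χ.e χ.mem
  rw [mul_smul, smul_comm] at h1
  change K.toFun (_ • χ.e ^ (p - 1) • χ.gen) = χ.gen ⊗ₜ _ at h1
  rw [pow_smul_gen _ _ (Nat.sub_ne_zero_of_lt hp.one_lt)] at h1
  rw [hs, monomial_add, monomial_nsmul, mul_smul, K.map_pow_smul]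
  change _ • K.toFun ((∏ i, χ.x i ^ (p - 1)) • χ.gen) = _
  rw [h1, TensorProduct.smul_tmul']

end FormChart

/-- The relative Cartier operator is unique: on a chart it is determined by its values on the forms
`x ^ s dx₁ ∧ ⋯ ∧ dxₙ`, which are prescribed, because the monomials generate over the `p`-th powers
and `R`. -/
theorem RelCartierOperator.eq_of_smooth {p : ℕ} [Fact p.Prime] {R S : Type*} [CommRing R]
    [IsNoetherianRing R] [CharP R p] [CommRing S] [CharP S p] [Algebra R S] [Algebra.Smooth R S]
    (K K' : RelCartierOperator p R S) : K = K' := by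
  have hp : p.Prime := Fact.out
  ext1
  ext1 z
  let I : Ideal S := LinearMap.eqLocus (LinearMap.toSpanSingleton S _ (K.toFun z))
    (LinearMap.toSpanSingleton S _ (K'.toFun z))
  have hI' : ∀ s, s ∈ I ↔ s • K.toFun z = s • K'.toFun z := fun s => Iff.rfl
  suffices hI : I = ⊤ by
    have := (hI' 1).1 (hI ▸ Submodule.mem_top)
    rwa [one_smul, one_smul] at this
  refine Ideal.eq_top_of_forall_exists_notMem I fun P => ?_
  obtain ⟨n, χ, hχ⟩ := FormChart.exists_f_notMem (R := R) P
  -- it suffices to compare the two operators on multiples of the generator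
  suffices h : ∀ y : S, 
      ∃ k : ℕ, χ.f ^ k • K.toFun (y • χ.gen) = χ.f ^ k • K'.toFun (y • χ.gen) by
    have hz : (χ.c ^ n * χ.e) ^ p • z =
        ((χ.c ^ n * χ.e) ^ (p - 1) * χ.coeffForm (χ.e • (z : ExteriorAlgebra S (Ω[S⁄R])))) •
          χ.gen := by
      rw [mul_smul, ← χ.smul_eq_smul_gen, smul_smul, ← pow_succ, Nat.sub_add_cancel hp.one_le]
    obtain ⟨k, hk⟩ := h ((χ.c ^ n * χ.e) ^ (p - 1) *
      χ.coeffForm (χ.e • (z : ExteriorAlgebra S (Ω[S⁄R]))))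
    rw [← hz, K.map_pow_smul, K'.map_pow_smul, smul_smul, smul_smul] at hk
    refine ⟨_, fun h => ?_, hk⟩
    rcases P.isPrime.mem_or_mem h with h | h
    · exact hχ (P.isPrime.mem_of_pow_mem _ h)
    · exact χ.c_pow_mul_e_notMem hχ h
  let T := Localization.Away χ.f
  have : CharP T p := IsLocalization.Away.charP p hχ
  let := χ.algebra T
  have := χ.isScalarTower T
  have := χ.formallyEtale T
  have := χ.finiteType T
  have hcoord : ∀ s : Fin n →₀ ℕ, coordPow R T s = algebraMap S T (χ.monomial s) := by
    intro s
    have : coordPow R T s = MvPolynomial.aeval (fun i => algebraMap S T (χ.x i))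
      (MvPolynomial.monomial s (1 : R)) := rfl
    rw [this, MvPolynomial.aeval_monomial, FormChart.monomial, Finsupp.prod_fintype]
    · simp
    · simp
  -- the operators agree on monomials
  have hmon : ∀ s : Fin n → ℕ,
      K.toFun (χ.monomial s • χ.gen) = K'.toFun (χ.monomial s • χ.gen) := by
    intro s
    by_cases h : ∀ i, p ∣ s i + 1
    · have h' : ∀ i, s i + 1 = p * ((s i + 1) / p - 1 + 1) := fun i => by
        rw [Nat.sub_add_cancel (Nat.div_pos (Nat.le_of_dvd (Nat.succ_pos _) (h i)) hp.pos),
          Nat.mul_div_cancel' (h i)]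
      rw [χ.toFun_monomial_smul_gen K h', χ.toFun_monomial_smul_gen K' h']
    · push Not at h
      obtain ⟨i, hi⟩ := h
      rw [χ.toFun_monomial_smul_gen_eq_zero K hi, χ.toFun_monomial_smul_gen_eq_zero K' hi]
  have hmon' : ∀ (s : Fin n → ℕ) (r : R) (t : S),
      K.toFun ((t ^ p * r • χ.monomial s) • χ.gen) =
        K'.toFun ((t ^ p * r • χ.monomial s) • χ.gen) := by
    intro s r t
    rw [mul_smul, K.map_pow_smul, K'.map_pow_smul, smul_assoc, K.map_smul_base, K'.map_smul_base,
      hmon]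
  have hclear : ∀ y y' : S, algebraMap S T y = algebraMap S T y' →
      ∃ k : ℕ, χ.f ^ k * y = χ.f ^ k * y' := by
    intro y y' h
    obtain ⟨⟨_, k, rfl⟩, hk⟩ := (IsLocalization.eq_iff_exists (.powers χ.f) T).1 h
    exact ⟨k, hk⟩
  -- every element of `T` has the form `y' / f ^ (k p)` with `K` and `K'` equal on `y' • gen`
  have key : ∀ y : T, ∃ (k : ℕ) (y' : S), algebraMap S T (χ.f ^ k) ^ p * y = algebraMap S T y' ∧
      K.toFun (y' • χ.gen) = K'.toFun (y' • χ.gen) := by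
    intro y
    have hy : y ∈ AddSubgroup.closure {y : T | ∃ (t : T) (r : R) (s : Fin n →₀ ℕ),
      y = t ^ p * r • coordPow R T s} := by
      rw [closure_pow_mul_coordPow p n R T]; trivial
    induction hy using AddSubgroup.closure_induction with
    | mem y hy =>
      obtain ⟨t, r, s, rfl⟩ := hy
      obtain ⟨⟨t', _, k, rfl⟩, ht⟩ := IsLocalization.surj (.powers χ.f) t
      refine ⟨k, t' ^ p * r • χ.monomial s, ?_, hmon' _ _ _⟩
      have ht' : t * algebraMap S T (χ.f ^ k) = algebraMap S T t' := ht
      rw [hcoord, ← mul_assoc, ← mul_pow, mul_comm _ t, ht', map_mul, map_pow, Algebra.smul_def,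
        Algebra.smul_def, map_mul, ← IsScalarTower.algebraMap_apply]
    | zero => exact ⟨0, 0, by simp, by simp⟩
    | add y z _ _ hy hz =>
      obtain ⟨k, y', hy, hy'⟩ := hy
      obtain ⟨l, z', hz, hz'⟩ := hz
      refine ⟨k + l, (χ.f ^ l) ^ p * y' + (χ.f ^ k) ^ p * z', ?_, ?_⟩
      · simp only [map_add, map_mul, ← hy, ← hz, map_pow]
        ring
      · simp only [add_smul, map_add, mul_smul, K.map_pow_smul, K'.map_pow_smul, hy', hz']
    | neg y _ hy =>
      obtain ⟨k, y', hy, hy'⟩ := hy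
      refine ⟨k, (-1) ^ p * y', ?_, ?_⟩
      · rw [map_mul, ← hy, map_pow _ (-1 : S), map_neg, map_one, ← frobenius_def p (-1 : T),
          map_neg, map_one, neg_one_mul, mul_neg]
      · rw [mul_smul, K.map_pow_smul, K'.map_pow_smul, hy']
  intro y
  obtain ⟨k, y', hy, hy'⟩ := key (algebraMap S T y)
  rw [← map_pow, ← map_mul] at hy
  obtain ⟨l, hl⟩ := hclear _ _ hy
  have hl' : (χ.f ^ (k + l)) ^ p * y = (χ.f ^ l) ^ p * y' := by
    have : (χ.f ^ l) ^ p = (χ.f ^ l) ^ (p - 1) * χ.f ^ l := by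
      rw [← pow_succ, Nat.sub_add_cancel hp.one_le]
    rw [this, mul_assoc, ← hl, ← mul_assoc, ← this]
    ring
  refine ⟨k + l, ?_⟩
  rw [← K.map_pow_smul, ← K'.map_pow_smul, ← mul_smul, hl', mul_smul, K.map_pow_smul,
    K'.map_pow_smul, hy']

end RelCartierOperator

/-! ### Cartier algebras and generic points -/

section

variable {R M : Type*} [CommRing R] [AddCommGroup M] [Module R M]

theorem Submodule.localized_eq_top_of_smul_mem {N : Submodule R M} {P : Ideal R} [P.IsPrime] {s : R}
    (hs : s ∉ P) (h : ∀ m, s • m ∈ N) : N.localized P.primeCompl = ⊤ := by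
  rw [eq_top_iff]
  intro y _
  obtain ⟨⟨m, t⟩, rfl⟩ := IsLocalizedModule.mk'_surjective P.primeCompl
    (LocalizedModule.mkLinearMap P.primeCompl M) y
  refine ⟨s • m, h m, ⟨s, hs⟩ * t, ?_⟩
  exact IsLocalizedModule.mk'_cancel_left _ m (⟨s, hs⟩ : P.primeCompl) t

theorem Submodule.exists_smul_mem_of_localized_eq_top [Module.Finite R M] {N : Submodule R M}
    {P : Ideal R} [P.IsPrime] (h : N.localized P.primeCompl = ⊤) :
    ∃ s ∉ P, ∀ m, s • m ∈ N := by
  have h1 : ∀ m, ∃ s ∉ P, s • m ∈ N := by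
    intro m
    have hm : LocalizedModule.mkLinearMap P.primeCompl M m ∈ N.localized P.primeCompl :=
      h ▸ Submodule.mem_top
    obtain ⟨y, hy, t, ht⟩ := hm
    rw [IsLocalizedModule.mk'_eq_iff, ← LinearMap.map_smul_of_tower] at ht
    obtain ⟨u, hu⟩ := (IsLocalizedModule.eq_iff_exists P.primeCompl _).1 ht
    refine ⟨(u * t : P.primeCompl), (u * t).2, ?_⟩
    have h2 : ((u * t : P.primeCompl) : R) • m = (u : R) • y := by
      rw [Submonoid.coe_mul, mul_smul]; exact hu.symm
    rw [h2]
    exact N.smul_mem _ hy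
  classical
  obtain ⟨G, hG⟩ := Module.finite_def.1 ‹Module.Finite R M›
  choose s hs hsm using h1
  refine ⟨∏ m ∈ G, s m, fun hmem => ?_, fun m => ?_⟩
  · obtain ⟨m, -, hm⟩ := (Ideal.IsPrime.prod_mem_iff (hp := ‹_›)).1 hmem
    exact hs m hm
  · have hle : Submodule.span R (G : Set M) ≤ N.comap (LinearMap.lsmul R M (∏ m ∈ G, s m)) := by
      rw [Submodule.span_le]
      intro y hy
      change (∏ m ∈ G, s m) • y ∈ N
      rw [← Finset.prod_erase_mul _ _ hy, mul_smul]
      exact N.smul_mem _ (hsm y)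
    exact hle (hG ▸ Submodule.mem_top)

end

namespace CartierAlgebra

variable {p : ℕ} {R M : Type*} [CommRing R] [AddCommGroup M] [Module R M]
  (C : CartierAlgebra p R M)

/-- The submodule spanned by the `φ n` with `n ∈ N` and `φ` homogeneous of degree at least `d`. -/
def spanFrom (d : ℕ) (N : Submodule R M) : Submodule R M :=
  Submodule.span R {x | ∃ e, d ≤ e ∧ ∃ φ ∈ C.deg e, ∃ n ∈ N, φ n = x}

variable {C}

theorem apply_mem_spanFrom {d e : ℕ} (h : d ≤ e) {N : Submodule R M} {φ : AddMonoid.End M}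
    (hφ : φ ∈ C.deg e) {n : M} (hn : n ∈ N) : φ n ∈ C.spanFrom d N :=
  Submodule.subset_span ⟨e, h, φ, hφ, n, hn, rfl⟩

/-- `C` maps `C_{≥ d} N` to `C_{≥ d + e} N` in degree `e`. -/
theorem map_spanFrom {d e : ℕ} {N : Submodule R M} {φ : AddMonoid.End M} (hφ : φ ∈ C.deg e)
    {m : M} (hm : m ∈ C.spanFrom d N) : φ m ∈ C.spanFrom (d + e) N := by
  induction hm using Submodule.closure_induction with
  | zero => rw [map_zero]; exact zero_mem _
  | add x y _ _ hx hy => rw [map_add]; exact add_mem hx hy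
  | smul_mem r x hx =>
    obtain ⟨e', he', ψ, hψ, n, hn, rfl⟩ := hx
    have hr : DistribSMul.toAddMonoidHom M r ∈ C.deg 0 := (C.mem_deg_zero _).2 ⟨r, fun m => rfl⟩
    have h := C.mul_mem _ _ _ _ hφ (C.mul_mem _ _ _ _ hr hψ)
    exact apply_mem_spanFrom (by omega) h hn

theorem spanFrom_top (hC : C.IsFPure) (d : ℕ) : C.spanFrom d ⊤ = ⊤ := by
  induction d with
  | zero =>
    refine eq_top_iff.2 fun m _ => ?_
    have h : (1 : AddMonoid.End M) ∈ C.deg 0 := (C.mem_deg_zero _).2 ⟨1, fun m => by simp⟩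
    exact apply_mem_spanFrom le_rfl h (N := ⊤) (n := m) trivial
  | succ d ih =>
    rw [eq_top_iff]
    refine hC.ge.trans ?_
    rw [plus, Submodule.span_le]
    rintro _ ⟨e, he, φ, hφ, m, -, rfl⟩
    have hm : m ∈ C.spanFrom d ⊤ := by rw [ih]; trivial
    refine Submodule.span_mono ?_ (map_spanFrom hφ hm)
    rintro _ ⟨e', he', h⟩
    exact ⟨e', by omega, h⟩

/-- Let `M` be `F`-regular, and let `I` be an ideal that is not contained in any generic point of
the support of `M`. Then `C_{≥ d} (I M) = M`: this is a Cartier submodule, and it contains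
`I C_{≥ d} M = I M`, which agrees with `M` generically. -/
theorem IsFRegular.spanFrom_smul_top (hC : C.IsFRegular) (hp : 0 < p) (d : ℕ) {I : Ideal R}
    (hI : ∀ η : PrimeSpectrum R, Minimal (· ∈ Module.support R M) η → ¬ I ≤ η.asIdeal) :
    C.spanFrom d (I • ⊤) = ⊤ := by
  refine hC.eq_top _ (fun e φ hφ m hm => ?_) (fun η hη => ?_)
  · refine Submodule.span_mono ?_ (map_spanFrom hφ hm)
    rintro _ ⟨e', he', h⟩
    exact ⟨e', by omega, h⟩
  · obtain ⟨x, hx, hxη⟩ := Set.not_subset.1 (hI η hη)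
    refine Submodule.localized_eq_top_of_smul_mem hxη fun m => ?_
    have hm : m ∈ C.spanFrom d ⊤ := by rw [spanFrom_top hC.isFPure]; trivial
    induction hm using Submodule.span_induction with
    | zero => rw [smul_zero]; exact zero_mem _
    | add y z _ _ hy hz => rw [smul_add]; exact add_mem hy hz
    | smul r y _ hy => rw [smul_comm]; exact Submodule.smul_mem _ _ hy
    | mem y hy =>
      obtain ⟨e, he, φ, hφ, n, -, rfl⟩ := hy
      rw [← C.map_pow_smul e φ hφ]
      exact apply_mem_spanFrom he hφ
        (Submodule.smul_mem_smul (I.pow_mem_of_mem hx _ (Nat.pow_pos hp)) trivial)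

end CartierAlgebra

/-! ### Iterates of the Cartier structure on monomial forms -/

theorem AddMonoid.End.pow_succ_apply {V : Type*} [AddCommGroup V] (κ : AddMonoid.End V) (e : ℕ)
    (v : V) : (κ ^ (e + 1)) v = (κ ^ e) (κ v) := by
  rw [pow_succ]; rfl

namespace FormChart

variable {p : ℕ} [Fact p.Prime] {R S M : Type*} [CommRing R] [CharP R p] [CommRing S] [CharP S p]
  [Algebra R S] [AddCommGroup M] [Module R M] {n : ℕ} (χ : FormChart R S n)
  (K : RelCartierOperator p R S) (κ : FrobeniusPushforward p R M →ₗ[R] M)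

theorem cartierEnd_shriekCartier_tmul (z : relTopForms R S) (m : M) :
    cartierEnd (shriekCartier K κ) (z ⊗ₜ m) = shriekAux S κ m (K.toFun z) := rfl

theorem cartierEnd_monomial_of_not_dvd {s : Fin n → ℕ} {i : Fin n} (hi : ¬ p ∣ s i + 1) (m : M) :
    cartierEnd (shriekCartier K κ) ((χ.monomial s • χ.gen) ⊗ₜ m) = 0 := by
  rw [cartierEnd_shriekCartier_tmul, χ.toFun_monomial_smul_gen_eq_zero K hi, map_zero]

theorem cartierEnd_monomial {s ν : Fin n → ℕ} (h : ∀ i, s i + 1 = p * (ν i + 1)) (m : M) :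
    cartierEnd (shriekCartier K κ) ((χ.monomial s • χ.gen) ⊗ₜ m) =
      (χ.monomial ν • χ.gen) ⊗ₜ cartierEnd κ m := by
  rw [cartierEnd_shriekCartier_tmul, χ.toFun_monomial_smul_gen K h, shriekAux_tmul, one_smul]
  rfl

theorem cartierEnd_pow_monomial_of_not_dvd (e : ℕ) {s : Fin n → ℕ} {i : Fin n}
    (hi : ¬ p ^ e ∣ s i + 1) (m : M) :
    (cartierEnd (shriekCartier K κ) ^ e) ((χ.monomial s • χ.gen) ⊗ₜ m) = 0 := by
  have hp : p.Prime := Fact.out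
  induction e generalizing s m with
  | zero => simp at hi
  | succ e ih =>
    rw [AddMonoid.End.pow_succ_apply]
    by_cases h : ∀ j, p ∣ s j + 1
    · have h' : ∀ j, s j + 1 = p * ((s j + 1) / p - 1 + 1) := fun j => by
        rw [Nat.sub_add_cancel (Nat.div_pos (Nat.le_of_dvd (Nat.succ_pos _) (h j)) hp.pos),
          Nat.mul_div_cancel' (h j)]
      rw [χ.cartierEnd_monomial K κ h', ih]
      intro hd
      refine hi ?_
      rw [h' i, pow_succ, mul_comm]
      exact mul_dvd_mul_left _ hd
    · push Not at h
      obtain ⟨j, hj⟩ := h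
      rw [χ.cartierEnd_monomial_of_not_dvd K κ hj, map_zero]

theorem cartierEnd_pow_monomial (e : ℕ) {s : Fin n → ℕ} (hs : ∀ i, s i + 1 = p ^ e) (m : M) :
    (cartierEnd (shriekCartier K κ) ^ e) ((χ.monomial s • χ.gen) ⊗ₜ m) =
      χ.gen ⊗ₜ (cartierEnd κ ^ e) m := by
  have hp : p.Prime := Fact.out
  induction e generalizing s m with
  | zero =>
    have hs0 : s = 0 := by ext i; simpa using hs i
    subst hs0
    simp [monomial]
  | succ e ih =>
    rw [AddMonoid.End.pow_succ_apply, AddMonoid.End.pow_succ_apply]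
    have h1 : 0 < p ^ e := Nat.pow_pos hp.pos
    rw [χ.cartierEnd_monomial K κ (ν := fun _ => p ^ e - 1), ih]
    · exact fun i => Nat.sub_add_cancel h1
    · intro i
      rw [Nat.sub_add_cancel h1, hs, pow_succ, mul_comm]

/-- Iterates of the Cartier structure of `f^! M` extract the coefficients of a polynomial `g` in the
coordinates, if all exponents are less than `p ^ e`. -/
theorem cartierEnd_pow_coeff (e : ℕ) (g : MvPolynomial (Fin n) R) (γ : Fin n →₀ ℕ)
    (hg : ∀ s ∈ g.support, ∀ i, s i < p ^ e) (hγ : ∀ i, γ i < p ^ e) (m : M) :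
    (cartierEnd (shriekCartier K κ) ^ e)
      (((χ.monomial (fun i => p ^ e - 1 - γ i) * MvPolynomial.aeval χ.x g) • χ.gen) ⊗ₜ m) =
      χ.gen ⊗ₜ (cartierEnd κ ^ e) (g.coeff γ • m) := by
  have hterm : ∀ s ∈ g.support, (cartierEnd (shriekCartier K κ) ^ e)
      (((χ.monomial (fun i => p ^ e - 1 - γ i) * (g.coeff s • χ.monomial s)) • χ.gen) ⊗ₜ m) =
      if s = γ then χ.gen ⊗ₜ (cartierEnd κ ^ e) (g.coeff γ • m) else 0 := by
    intro s hs
    rw [mul_smul_comm, ← monomial_add, smul_assoc, TensorProduct.smul_tmul]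
    split_ifs with h
    · subst h
      refine χ.cartierEnd_pow_monomial K κ e (fun i => ?_) _
      have := hγ i
      simp only [Pi.add_apply]
      omega
    · have : ∃ i, s i ≠ γ i := by
        by_contra! h'
        exact h (Finsupp.ext h')
      obtain ⟨i, hi⟩ := this
      refine χ.cartierEnd_pow_monomial_of_not_dvd K κ e (i := i) (fun hd => ?_) _
      have h1 := hγ i
      have h2 := hg s hs i
      simp only [Pi.add_apply] at hd
      -- `(pᵉ - 1 - γᵢ) + sᵢ + 1` lies strictly between `0` and `2 pᵉ`
      obtain ⟨k, hk⟩ := hd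
      have hk1 : k = 1 := by
        have h3 : p ^ e * k < p ^ e * 2 := by omega
        have h4 : k < 2 := lt_of_mul_lt_mul_left' h3
        have h5 : k ≠ 0 := by rintro rfl; omega
        omega
      subst hk1
      omega
  have hx : MvPolynomial.aeval χ.x g = ∑ s ∈ g.support, g.coeff s • χ.monomial s := by
    conv_lhs => rw [g.as_sum, map_sum]
    exact Finset.sum_congr rfl fun s _ => χ.aeval_monomial s _
  rw [hx, Finset.mul_sum, Finset.sum_smul, TensorProduct.sum_tmul, map_sum,
    Finset.sum_congr rfl hterm, Finset.sum_ite_eq']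
  split_ifs with h
  · rfl
  · rw [MvPolynomial.notMem_support_iff.1 h, zero_smul, map_zero, TensorProduct.tmul_zero]

end FormChart

/-! ### Ascent of `F`-regularity -/

theorem Submodule.mem_colon_univ {R M : Type*} [CommRing R] [AddCommMonoid M]
    [Module R M] {N : Submodule R M} {r : R} : r ∈ N.colon Set.univ ↔ ∀ m, r • m ∈ N := by
  simp [Submodule.mem_colon]

/-- The support of `f^! M` lies over the support of `M`. -/
theorem comap_mem_support {R S M : Type*} [CommRing R] [CommRing S] [Algebra R S]
    [AddCommGroup M] [Module R M] [Module.Finite R M] {η : PrimeSpectrum S}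
    (hη : η ∈ Module.support S (ShriekModule R S M)) :
    PrimeSpectrum.comap (algebraMap R S) η ∈ Module.support R M := by
  rw [Module.mem_support_iff_of_finite]
  intro r hr
  refine Module.annihilator_le_of_mem_support hη ?_
  rw [Module.mem_annihilator] at hr ⊢
  intro w
  induction w using TensorProduct.induction_on with
  | zero => rw [smul_zero]
  | add x y hx hy => rw [smul_add, hx, hy, add_zero]
  | tmul z m => rw [algebraMap_smul, ← TensorProduct.tmul_smul, hr, TensorProduct.tmul_zero]

namespace FormChart

/-- Let `J` be an ideal of `S` that is not contained in any generic point of the support of `f^! M`.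
Then the coefficients of the polynomials `g` in the coordinates of a chart such that `g(x)` is in
`J` on the chart do not all vanish at a generic point `q` of the support of `M`. Otherwise there is
a prime `Q` of the chart over `J` whose restriction to affine space is contained in `q R[x]`. It
lies in the support of `f^! M`, and it is minimal there: a smaller prime `Q'` of the support lies
over `q`, so that both `Q` and `Q'` restrict to `q R[x]`, and there are no inclusions between
primes in the fibres of an étale morphism. -/
theorem exists_coeff_notMem {R S M : Type*} [CommRing R] [CommRing S]
    [Algebra R S] [Algebra.Smooth R S] [AddCommGroup M] [Module R M] [Module.Finite R M]
    {n : ℕ} (χ : FormChart R S n) {J : Ideal S}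
    [Module.Finite S (ShriekModule R S M)]
    (hann : Module.annihilator S (ShriekModule R S M) ≤ J)
    (hJ : ∀ η : PrimeSpectrum S, Minimal (· ∈ Module.support S (ShriekModule R S M)) η →
      ¬ J ≤ η.asIdeal)
    {q : PrimeSpectrum R} (hq : Minimal (· ∈ Module.support R M) q) :
    ∃ (g : MvPolynomial (Fin n) R) (k : ℕ) (γ : Fin n →₀ ℕ),
      χ.f ^ k * MvPolynomial.aeval χ.x g ∈ J ∧ g.coeff γ ∉ q.asIdeal := by
  by_contra! hcon
  let T := Localization.Away χ.f
  let := χ.algebra T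
  have := χ.isScalarTower T
  have := χ.formallyEtale T
  have := χ.finiteType T
  let qB : Ideal (MvPolynomial (Fin n) R) := q.asIdeal.map MvPolynomial.C
  have : qB.IsPrime := by
    have h := MvPolynomial.ker_map (σ := Fin n) (Ideal.Quotient.mk q.asIdeal)
    rw [Ideal.mk_ker] at h
    change (q.asIdeal.map MvPolynomial.C).IsPrime
    rw [← h]
    exact RingHom.ker_isPrime _
  have haeval : ∀ g : MvPolynomial (Fin n) R,
      algebraMap _ T g = algebraMap S T (MvPolynomial.aeval χ.x g) := by
    intro g
    change MvPolynomial.aeval (fun i => algebraMap S T (χ.x i)) g = _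
    exact MvPolynomial.aeval_algebraMap_apply T χ.x g
  obtain ⟨Q, hJQ, hQ, hQq⟩ := Ideal.exists_ideal_comap_le_prime
    (f := algebraMap (MvPolynomial (Fin n) R) T) qB (J.map (algebraMap S T)) (by
      intro g hg
      rw [Ideal.mem_comap, haeval,
        IsLocalization.algebraMap_mem_map_algebraMap_iff (.powers χ.f)] at hg
      obtain ⟨_, ⟨k, rfl⟩, hk⟩ := hg
      exact MvPolynomial.mem_map_C_iff.2 fun γ => hcon g k γ hk)
  let η₀ : PrimeSpectrum S := ⟨Q.comap (algebraMap S T), Ideal.IsPrime.comap _⟩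
  have hJη : J ≤ η₀.asIdeal := Ideal.map_le_iff_le_comap.1 hJQ
  refine hJ η₀ ⟨Module.mem_support_iff_of_finite.2 (hann.trans hJη), fun η hη hle => ?_⟩ hJη
  have hle' : η.asIdeal ≤ Q.comap (algebraMap S T) := hle
  have hdisj : Disjoint (Submonoid.powers χ.f : Set S) η.asIdeal := by
    rw [Set.disjoint_left]
    rintro _ ⟨k, rfl⟩ hk
    have h1 : algebraMap S T (χ.f ^ k) ∈ Q := hle' hk
    rw [map_pow] at h1
    exact hQ.ne_top (Ideal.eq_top_of_isUnit_mem _ h1 ((χ.isUnit_f T).pow k))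
  let Q' : Ideal T := η.asIdeal.map (algebraMap S T)
  have hQ' : Q'.IsPrime :=
    IsLocalization.isPrime_of_isPrime_disjoint (.powers χ.f) T _ η.isPrime hdisj
  have hQQ : Q' ≤ Q := Ideal.map_le_iff_le_comap.2 hle'
  have hqη : q.asIdeal ≤ η.asIdeal.comap (algebraMap R S) := by
    refine hq.2 (comap_mem_support hη) fun r hr => ?_
    have h1 : MvPolynomial.C r ∈ qB := hQq (by
      rw [Ideal.mem_comap, ← MvPolynomial.algebraMap_eq, ← IsScalarTower.algebraMap_apply,
        IsScalarTower.algebraMap_apply R S T]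
      exact hle' hr)
    simpa using MvPolynomial.mem_map_C_iff.1 h1 0
  have hunder : Q'.under (MvPolynomial (Fin n) R) = Q.under (MvPolynomial (Fin n) R) := by
    refine le_antisymm (Ideal.comap_mono hQQ) (hQq.trans ?_)
    refine Ideal.map_le_iff_le_comap.2 fun r hr => ?_
    change algebraMap _ T (MvPolynomial.C r) ∈ Q'
    rw [← MvPolynomial.algebraMap_eq, ← IsScalarTower.algebraMap_apply,
        IsScalarTower.algebraMap_apply R S T]
    exact Ideal.mem_map_of_mem _ (hqη hr)
  -- an étale algebra is quasi-finite, so that its fibres carry no inclusions between primes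
  have hQeq : Q' = Q := Algebra.QuasiFinite.eq_of_le_of_under_eq
    (R := MvPolynomial (Fin n) R) Q' Q hQQ hunder
  have hcomap : Q'.comap (algebraMap S T) = η.asIdeal :=
    IsLocalization.under_map_of_isPrime_disjoint (.powers χ.f) T η.isPrime hdisj
  change Q.comap (algebraMap S T) ≤ η.asIdeal
  rw [← hQeq, hcomap]

end FormChart

theorem cartierEnd_pow_smul_mem_plus {p : ℕ} {R M : Type*} [CommRing R] [Fact p.Prime] [CharP R p]
    [AddCommGroup M] [Module R M] (κ : FrobeniusPushforward p R M →ₗ[R] M) {a : Ideal R} {t : ℚ}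
    {e : ℕ} (he : 0 < e) {y : R} (hy : y ∈ testIdealPow p a t e) {N : Submodule R M} {m : M}
    (hm : m ∈ N) : (cartierEnd κ ^ e) (y • m) ∈ (idealPowCartierAlgebra κ a t).plus N :=
  Submodule.subset_span ⟨e, he, (cartierEnd κ ^ e : M →+ M).comp (DistribSMul.toAddMonoidHom M y),
    ⟨y, hy, fun _ => rfl⟩, m, hm, rfl⟩

theorem testIdealPow_map {p : ℕ} {R S : Type*} [CommRing R] [CommRing S] (f : R →+* S)
    {a : Ideal R} {t : ℚ} {e : ℕ} {y : R} (hy : y ∈ testIdealPow p a t e) :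
    f y ∈ testIdealPow p (a.map f) t e := by
  unfold testIdealPow at *
  split_ifs at * with h
  · trivial
  · rw [← Ideal.map_pow]
    exact Ideal.mem_map_of_mem _ hy

/-- If `M` is `F`-regular and `J` is an ideal that is not contained in any generic point of the
support of `f^! M`, then `C₊ (J f^! M) = f^! M`. On a chart, this follows from the corresponding
statement for `M` and the ideal of the coefficients of the polynomials in `J`, since
`κ^e(x ^ (p ^ e - 1 - γ) g dx₁ ∧ ⋯ ∧ dxₙ ⊗ m) = dx₁ ∧ ⋯ ∧ dxₙ ⊗ κ^e(g_γ m)` for large `e`. -/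
theorem plus_smul_top {p : ℕ} [Fact p.Prime] {R S M : Type*} [CommRing R] [IsNoetherianRing R]
    [CharP R p] [CommRing S] [CharP S p] [Algebra R S] [Algebra.Smooth R S] {a : Ideal R} {t : ℚ}
    [AddCommGroup M] [Module R M] {κ : FrobeniusPushforward p R M →ₗ[R] M}
    (hM : (idealPowCartierAlgebra κ a t).IsFRegular) (K : RelCartierOperator p R S)
    [Module.Finite S (ShriekModule R S M)] {J : Ideal S}
    (hann : Module.annihilator S (ShriekModule R S M) ≤ J)
    (hJ : ∀ η : PrimeSpectrum S, Minimal (· ∈ Module.support S (ShriekModule R S M)) η →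
      ¬ J ≤ η.asIdeal) :
    (idealPowCartierAlgebra (M := ShriekModule R S M) (shriekCartier K κ)
      (a.map (algebraMap R S)) t).plus (J • ⊤) = ⊤ := by
  have hp : p.Prime := Fact.out
  have := hM.finite
  let N := (idealPowCartierAlgebra (M := ShriekModule R S M) (shriekCartier K κ)
    (a.map (algebraMap R S)) t).plus (J • ⊤)
  change N = ⊤
  suffices h : N.colon Set.univ = ⊤ by
    have h1 : (1 : S) ∈ N.colon Set.univ := h ▸ Submodule.mem_top
    rw [Submodule.mem_colon_univ] at h1
    exact eq_top_iff.2 fun w _ => by simpa using h1 w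
  refine Ideal.eq_top_of_forall_exists_notMem _ fun P => ?_
  obtain ⟨n, χ, hχ⟩ := FormChart.exists_f_notMem (R := R) P
  let A : Set R := {r | ∃ (g : MvPolynomial (Fin n) R) (k : ℕ) (γ : Fin n →₀ ℕ),
    χ.f ^ k * MvPolynomial.aeval χ.x g ∈ J ∧ g.coeff γ = r}
  have hA : ∀ q : PrimeSpectrum R, Minimal (· ∈ Module.support R M) q →
      ¬ Ideal.span A ≤ q.asIdeal := by
    intro q hq hle
    obtain ⟨g, k, γ, h1, h2⟩ := χ.exists_coeff_notMem hann hJ hq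
    exact h2 (hle (Ideal.subset_span ⟨g, k, γ, h1, rfl⟩))
  -- finitely many polynomials suffice, which bounds their exponents and the powers of `f`
  obtain ⟨A', hA', hspan⟩ := (Submodule.fg_span_iff_fg_span_finset_subset A).1
    (IsNoetherian.noetherian (Ideal.span A))
  have hspan' : Ideal.span A = Ideal.span (A' : Set R) := hspan
  have hA'' : ∀ r ∈ A', r ∈ A := fun r hr => hA' hr
  choose! g k γ hgJ hgγ using hA''
  let k₀ := A'.sup k
  let d := A'.sup fun r =>
    ((g r).support.sup fun s => Finset.univ.sup s) ⊔ Finset.univ.sup (γ r)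
  -- the coefficients of the `g r` are extracted by operators of high degree
  have hcore : ∀ (e : ℕ) (φ : AddMonoid.End M), d + 1 ≤ e →
      φ ∈ (idealPowCartierAlgebra κ a t).deg e → ∀ r ∈ A', ∀ m : M,
      χ.f ^ k₀ • (χ.gen ⊗ₜ[R] φ (r • m) : ShriekModule R S M) ∈ N := by
    rintro e φ he ⟨y, hy, hφ⟩ r hr m
    have hd : ∀ i ≤ d, i < p ^ e := fun i hi =>
      (Nat.lt_of_le_of_lt hi he).trans (Nat.lt_pow_self hp.one_lt)
    have hdr := Finset.le_sup (f := fun r =>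
      ((g r).support.sup fun s => Finset.univ.sup s) ⊔ Finset.univ.sup (γ r)) hr
    have hsupp : ∀ s ∈ (g r).support, ∀ i, s i < p ^ e := fun s hs i => hd _ <|
      (Finset.le_sup (f := s) (Finset.mem_univ i)).trans <|
        (Finset.le_sup (f := fun s : Fin n →₀ ℕ => Finset.univ.sup s) hs).trans <|
          le_sup_left.trans hdr
    have hγ : ∀ i, γ r i < p ^ e := fun i => hd _ <|
      (Finset.le_sup (f := γ r) (Finset.mem_univ i)).trans <| le_sup_right.trans hdr
    have h1 := χ.cartierEnd_pow_coeff K κ e (g r) (γ r) hsupp hγ (y • m)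
    rw [hgγ r hr, smul_comm, ← hφ] at h1
    have h3 : (χ.f ^ k₀) ^ p ^ e •
        (((χ.monomial (fun i => p ^ e - 1 - γ r i) * MvPolynomial.aeval χ.x (g r)) • χ.gen) ⊗ₜ[R]
          (y • m) : ShriekModule R S M) = algebraMap R S y •
        ((χ.f ^ k₀) ^ p ^ e * (χ.monomial (fun i => p ^ e - 1 - γ r i) *
          MvPolynomial.aeval χ.x (g r))) • (χ.gen ⊗ₜ[R] m) := by
      rw [algebraMap_smul, TensorProduct.tmul_smul, smul_comm _ y, mul_smul ((χ.f ^ k₀) ^ p ^ e),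
        ← TensorProduct.smul_tmul']
    rw [← h1, ← cartierEnd_pow_smul, h3]
    refine cartierEnd_pow_smul_mem_plus _ (by omega) (testIdealPow_map _ hy)
      (Submodule.smul_mem_smul ?_ trivial)
    have hk : k r ≤ k₀ * p ^ e :=
      (Finset.le_sup (f := k) hr).trans (Nat.le_mul_of_pos_right _ (Nat.pow_pos hp.pos))
    rw [← pow_mul, ← Nat.sub_add_cancel hk, pow_add]
    have h2 := J.mul_mem_left (χ.f ^ (k₀ * p ^ e - k r) *
      χ.monomial (fun i => p ^ e - 1 - γ r i)) (hgJ r hr)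
    convert h2 using 1
    ring
  have hgen : ∀ m : M, χ.f ^ k₀ • (χ.gen ⊗ₜ[R] m : ShriekModule R S M) ∈ N := by
    intro m
    have hm : m ∈ (idealPowCartierAlgebra κ a t).spanFrom (d + 1) (Ideal.span A • ⊤) := by
      rw [hM.spanFrom_smul_top hp.pos _ hA]; trivial
    induction hm using Submodule.span_induction with
    | zero => rw [TensorProduct.tmul_zero, smul_zero]; exact zero_mem _
    | add x y _ _ hx hy => rw [TensorProduct.tmul_add, smul_add]; exact add_mem hx hy
    | smul r x _ hx =>
      rw [TensorProduct.tmul_smul, ← algebraMap_smul S r, smul_comm]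
      exact N.smul_mem _ hx
    | mem x hx =>
      obtain ⟨e, he, φ, hφ, w, hw, rfl⟩ := hx
      rw [hspan'] at hw
      induction hw using Submodule.smul_induction_on' with
      | smul r hr m _ =>
        induction hr using Submodule.span_induction generalizing m with
        | mem r hr => exact hcore e φ he hφ r hr m
        | zero => rw [zero_smul, map_zero, TensorProduct.tmul_zero, smul_zero]; exact zero_mem _
        | add x y _ _ hx hy =>
          rw [add_smul, map_add, TensorProduct.tmul_add, smul_add]
          exact add_mem (hx m trivial) (hy m trivial)
        | smul c x _ hx =>
          rw [smul_eq_mul, mul_comm, mul_smul]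
          exact hx _ trivial
      | add x _ y _ hx hy =>
        rw [map_add, TensorProduct.tmul_add, smul_add]
        exact add_mem hx hy
  refine ⟨χ.f ^ k₀ * (χ.c ^ n * χ.e), fun h => ?_, ?_⟩
  · rcases P.isPrime.mem_or_mem h with h | h
    · exact hχ (P.isPrime.mem_of_pow_mem _ h)
    · exact χ.c_pow_mul_e_notMem hχ h
  · rw [Submodule.mem_colon_univ]
    intro w
    induction w using TensorProduct.induction_on with
    | zero => rw [smul_zero]; exact zero_mem _
    | add x y hx hy => rw [smul_add]; exact add_mem hx hy
    | tmul z m =>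
      rw [mul_smul, TensorProduct.smul_tmul', χ.smul_eq_smul_gen, ← TensorProduct.smul_tmul',
        smul_comm]
      exact N.smul_mem _ (hgen m)

end

theorem theorem3p7 {p : ℕ} [Fact p.Prime] {R S M : Type*} [CommRing R] [CharP R p]
    (hR : IsFFinite p R) [CommRing S] [CharP S p] [Algebra R S] [Algebra.Smooth R S]
    (a : Ideal R) (t : ℚ) [AddCommGroup M] [Module R M]
    (κ : FrobeniusPushforward p R M →ₗ[R] M)
    (hM : (idealPowCartierAlgebra κ a t).IsFRegular) :
    ∃ K : RelCartierOperator p R S, (∀ K' : RelCartierOperator p R S, K' = K) ∧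
      (idealPowCartierAlgebra (shriekCartier K κ)
        (a.map (algebraMap R S)) t).IsFRegular := by
  have := hR.isNoetherianRing
  have := hM.finite
  have := relTopForms_finite R S
  have hfin : Module.Finite S (ShriekModule R S M) :=
    Module.Finite.tensorProduct_of_isScalarTower R S _ _
  obtain ⟨K⟩ := exists_relCartierOperator (S := S) hR
  refine ⟨K, fun K' => K'.eq_of_smooth K, hfin, ?_, fun N hN hgen => ?_⟩
  · have h := plus_smul_top hM K (J := ⊤) le_top fun η _ hη => η.isPrime.ne_top (top_le_iff.1 hη)
    rwa [Submodule.top_smul] at h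
  · refine top_le_iff.1 ((plus_smul_top hM K
      (J := N.colon Set.univ) ?_ ?_).ge.trans ?_)
    · intro s hs
      refine Submodule.mem_colon_univ.2 fun w => ?_
      rw [Module.mem_annihilator.1 hs w]
      exact zero_mem _
    · intro η hη hle
      obtain ⟨s, hs, hsN⟩ := Submodule.exists_smul_mem_of_localized_eq_top (hgen η hη)
      exact hs (hle (Submodule.mem_colon_univ.2 hsN))
    · refine Submodule.span_le.2 ?_
      rintro _ ⟨e, -, φ, hφ, w, hw, rfl⟩
      refine hN e φ hφ w ?_
      refine Submodule.smul_le.2 (fun s hs w _ => ?_) hw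
      exact Submodule.mem_colon_univ.1 hs w
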